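/- **Setting.** Let $\mathbf O$ be the real octonions with conjugation $\overline{x}$, inner product $(x|y)$ and natural orthonormal units $1=e_0,e_1,\dots,e_7$, and let $\mathrm{Im}\,\mathbf O=\mathrm{span}(e_1,\dots,e_7)$. For $\xi_i\in\mathbb R$, $x_i\in\mathbf O$ put $$h^1(\xi_1,\xi_2,\xi_3;x_1,x_2,x_3)=\begin{pmatrix}\xi_1&\sqrt{-1}\,x_3&\sqrt{-1}\,\overline{x_2}\\ \sqrt{-1}\,\overline{x_3}&\xi_2&x_1\\ \sqrt{-1}\,x_2&\overline{x_1}&\xi_3\end{pmatrix},$$ a matrix over the complexified octonions. Let $\mathcal J^1$ be the real vector space of all these matrices, with Jordan product $X\circ Y=\frac12(XY+YX)$, $\mathrm{tr}(X)=\xi_1+\xi_2+\xi_3$, $(X|Y)=\mathrm{tr}(X\circ Y)$, $E=h^1(1,1,1;0,0,0)$, and $X\times Y=\frac12\bigl(2X\circ Y-\mathrm{tr}(X)Y-\mathrm{tr}(Y)X+(\mathrm{tr}(X)\mathrm{tr}(Y)-(X|Y))E\bigr)$. Let $\mathrm F_{4(-20)}=\{g\in \mathrm{GL}_{\mathbb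 R}(\mathcal J^1): g(X\circ Y)=gX\circ gY \text{ for all } X,Y\}$ with the topology induced from $\mathrm{GL}_{\mathbb R}(\mathcal J^1)$. Let $E_i$ be the diagonal idempotents and $F_i^1(x)$ the element $h^1(0,0,0;\ldots)$ with $x$ as its $i$-th octonion entry and zeros elsewhere. Put $P^-=h^1(-1,1,0;0,0,1)$, $Q^{\pm}(x)=h^1(0,0,0;x,\pm\overline x,0)$, and let $\sigma\in\mathrm F_{4(-20)}$ be the map $h^1(\xi_1,\xi_2,\xi_3;x_1,x_2,x_3)\mapsto h^1(\xi_1,\xi_2,\xi_3;x_1,-x_2,-x_3)$. For $a\in\mathbf O$ let $\tilde A_i^1(a)=4[L(E_{i+1}),L(F_i^1(a))]$ (indices mod 3), where $L(X)Y=X\circ Y$; this is a derivation of $\mathcal J^1$. For $p\in\mathrm{Im}\,\mathbf O$ let $\delta(p)$ be the derivation $h^1(\xi_1,\xi_2,\xi_3;x_1,x_2,x_3)\mapsto h^1(0,0,0;px_1,x_2p,-(px_3+x_3p))$. Put $\mathcal G_{\pm1}(x)=\tilde A_1^1(x)+\tilde A_2^1(\mp\overline x)$ and $\mathcal G_{\pm2}(p)=\tilde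 A_3^1(\mp p)-\delta(p)$. Define $K=\{g\in\mathrm F_{4(-20)}:\sigma g\sigma^{-1}=g\}$, $M=\{k\in K:k\tilde A_3^1(1)k^{-1}=\tilde A_3^1(1)\}$, $A=\{\exp(t\tilde A_3^1(1)):t\in\mathbb R\}$, and $N^\pm=\{\exp(\mathcal G_{\pm1}(x)+\mathcal G_{\pm2}(p)):x\in\mathbf O,\ p\in\mathrm{Im}\,\mathbf O\}$. Let $\mathcal N_1^-=\{X\in\mathcal J^1:X\times X=0,\ \mathrm{tr}(X)=0,\ (E_1|X)<0\}$. For $X\in\mathcal N_1^-$ let $[X]$ be its class under the relation $X\sim Y\iff Y=rX$ for some $r>0$; $\mathrm F_{4(-20)}$ acts by $g[X]=[gX]$. For $g\in\mathrm F_{4(-20)}$ let $n_I(g)\in N^+$ be the $N^+$-factor of $g$ in the Iwasawa decomposition: every $g$ is uniquely $g=k\,a\,n$ with $k\in K$, $a\in A$, $n\in N^+$, and $$n=n_I(g)=\exp\Bigl(\mathcal G_1\Bigl(\tfrac12\tfrac{\sum_{i=0}^7(gQ^+(e_i)|E_1)e_i}{(gP^-|E_1)}\Bigr)+\mathcal G_2\Bigl(-\tfrac12\tfrac{\sum_{i=1}^7(gF_3^1(e_i)|E_1)e_i}{(gP^-|E_1)}\Bigr)\Bigr).$$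 **Theorem.** (1) (Explicit Bruhat decomposition.) $\mathrm F_{4(-20)}$ is the disjoint union of $N^-MAN^+$ and $\sigma MAN^+$, where $$N^-MAN^+=\{g:(gP^-|\sigma P^-)\neq0\}=\{g:(gP^-|\sigma P^-)>0\},$$ $$\sigma MAN^+=N^-\sigma MAN^+=\{g:(gP^-|\sigma P^-)=0\}=\{g:g[P^-]=[\sigma P^-]\}.$$ Furthermore, $N^-MAN^+$ is open and dense in $\mathrm F_{4(-20)}$. (2) (Explicit Gauss decomposition.) For every $g\in N^-MAN^+$ there exist unique $n_G^-(g)\in N^-$, $m_G(g)\in M$, $a_G(g)\in A$, $n_G^+(g)\in N^+$ such that $g=n_G^-(g)\,m_G(g)\,a_G(g)\,n_G^+(g)$, and they are given by $$a_G(g)=\exp\bigl(\tfrac12\log\bigl(\tfrac14(gP^-|\sigma P^-)\bigr)\tilde A_3^1(1)\bigr),$$ $$n_G^-(g)=\exp\Bigl(\mathcal G_{-1}\Bigl(-\tfrac12\tfrac{\sum_{i=0}^7(Q^-(e_i)|gP^-)e_i}{(gP^-|\sigma P^-)}\Bigr)+\mathcal G_{-2}\Bigl(-\tfrac12\tfrac{\sum_{i=1}^7(F_3^1(e_i)|gP^-)e_i}{(gP^-|\sigma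 P^-)}\Bigr)\Bigr),$$ $$n_G^+(g)=n_I\bigl(n_G^-(g)^{-1}g\bigr),\qquad m_G(g)=n_G^-(g)^{-1}\,g\,n_G^+(g)^{-1}\,a_G(g)^{-1}.$$ -/

import Mathlib

open scoped Quaternion Pointwise

noncomputable section

namespace Exceptional

/-! ### Octonions -/

/-- Octonions over a commutative ring `R` (Cayley-Dickson doubling of the quaternions):
the pair `(a, b)` stands for `a + b e₄`.  `Oct ℝ` is the division algebra `𝐎` and `Oct ℂ` is
its complexification. -/
def Oct (R : Type) [CommRing R] : Type := ℍ[R] × ℍ[R]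

namespace Oct

variable {R : Type} [CommRing R]

instance : AddCommGroup (Oct R) := inferInstanceAs (AddCommGroup (ℍ[R] × ℍ[R]))

instance : Module R (Oct R) := inferInstanceAs (Module R (ℍ[R] × ℍ[R]))

/-- `(a + b e₄)(c + d e₄) = (a c - d̄ b) + (d a + b c̄) e₄`. -/
instance : Mul (Oct R) :=
  ⟨fun x y => (x.1 * y.1 - star y.2 * x.2, y.2 * x.1 + x.2 * star y.1)⟩

instance : One (Oct R) := ⟨((1 : ℍ[R]), (0 : ℍ[R]))⟩

/-- Conjugation (`R`-linear). -/
def conj (x : Oct R) : Oct R := (star x.1, -x.2)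

/-- The real part, i.e. the coefficient of `1 = e₀`. -/
def re (x : Oct R) : R := x.1.re

/-- The inner product `(x|y)`, the real part of `x ȳ`; the units `e₀, …, e₇` are orthonormal. -/
def ip (x y : Oct R) : R := re (x * conj y)

instance : NormedAddCommGroup (Oct ℝ) := inferInstanceAs (NormedAddCommGroup (ℍ[ℝ] × ℍ[ℝ]))

instance : NormedSpace ℝ (Oct ℝ) := inferInstanceAs (NormedSpace ℝ (ℍ[ℝ] × ℍ[ℝ]))

instance : FiniteDimensional ℝ (Oct ℝ) :=
  inferInstanceAs (FiniteDimensional ℝ (ℍ[ℝ] × ℍ[ℝ]))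

/-- The natural units `e₀ = 1, e₁, …, e₇`. -/
def e (i : Fin 8) : Oct ℝ :=
  (⟨if i = 0 then 1 else 0, if i = 1 then 1 else 0, if i = 2 then 1 else 0,
      if i = 3 then 1 else 0⟩,
    ⟨if i = 4 then 1 else 0, if i = 5 then 1 else 0, if i = 6 then 1 else 0,
      if i = 7 then 1 else 0⟩)

/-- The inclusion of `𝐎` into its complexification. -/
def toC (x : Oct ℝ) : Oct ℂ :=
  (⟨x.1.re, x.1.imI, x.1.imJ, x.1.imK⟩, ⟨x.2.re, x.2.imI, x.2.imJ, x.2.imK⟩)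

section Lemmas

theorem ext {x y : Oct R} (h₁ : x.1 = y.1) (h₂ : x.2 = y.2) : x = y := Prod.ext h₁ h₂

@[simp] theorem fst_zero : (0 : Oct R).1 = 0 := rfl
@[simp] theorem snd_zero : (0 : Oct R).2 = 0 := rfl
@[simp] theorem fst_one : (1 : Oct R).1 = 1 := rfl
@[simp] theorem snd_one : (1 : Oct R).2 = 0 := rfl
@[simp] theorem fst_add (x y : Oct R) : (x + y).1 = x.1 + y.1 := rfl
@[simp] theorem snd_add (x y : Oct R) : (x + y).2 = x.2 + y.2 := rfl
@[simp] theorem fst_sub (x y : Oct R) : (x - y).1 = x.1 - y.1 := rfl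
@[simp] theorem snd_sub (x y : Oct R) : (x - y).2 = x.2 - y.2 := rfl
@[simp] theorem fst_neg (x : Oct R) : (-x).1 = -x.1 := rfl
@[simp] theorem snd_neg (x : Oct R) : (-x).2 = -x.2 := rfl
@[simp] theorem fst_smul (r : R) (x : Oct R) : (r • x).1 = r • x.1 := rfl
@[simp] theorem snd_smul (r : R) (x : Oct R) : (r • x).2 = r • x.2 := rfl
@[simp] theorem fst_mul (x y : Oct R) : (x * y).1 = x.1 * y.1 - star y.2 * x.2 := rfl
@[simp] theorem snd_mul (x y : Oct R) : (x * y).2 = y.2 * x.1 + x.2 * star y.1 := rfl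
@[simp] theorem fst_conj (x : Oct R) : x.conj.1 = star x.1 := rfl
@[simp] theorem snd_conj (x : Oct R) : x.conj.2 = -x.2 := rfl

@[simp] theorem fst_re_toC (x : Oct ℝ) : x.toC.1.re = x.1.re := rfl
@[simp] theorem fst_imI_toC (x : Oct ℝ) : x.toC.1.imI = x.1.imI := rfl
@[simp] theorem fst_imJ_toC (x : Oct ℝ) : x.toC.1.imJ = x.1.imJ := rfl
@[simp] theorem fst_imK_toC (x : Oct ℝ) : x.toC.1.imK = x.1.imK := rfl
@[simp] theorem snd_re_toC (x : Oct ℝ) : x.toC.2.re = x.2.re := rfl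
@[simp] theorem snd_imI_toC (x : Oct ℝ) : x.toC.2.imI = x.2.imI := rfl
@[simp] theorem snd_imJ_toC (x : Oct ℝ) : x.toC.2.imJ = x.2.imJ := rfl
@[simp] theorem snd_imK_toC (x : Oct ℝ) : x.toC.2.imK = x.2.imK := rfl

protected theorem mul_add (x y z : Oct R) : x * (y + z) = x * y + x * z := by
  apply Oct.ext <;> simp <;> noncomm_ring

protected theorem add_mul (x y z : Oct R) : (x + y) * z = x * z + y * z := by
  apply Oct.ext <;> simp <;> noncomm_ring

protected theorem mul_smul (r : R) (x y : Oct R) : x * (r • y) = r • (x * y) := by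
  apply Oct.ext <;> simp [smul_sub]

protected theorem smul_mul (r : R) (x y : Oct R) : (r • x) * y = r • (x * y) := by
  apply Oct.ext <;> simp [smul_sub]

theorem conj_add (x y : Oct R) : (x + y).conj = x.conj + y.conj := by
  apply Oct.ext <;> simp [add_comm]

theorem conj_sub (x y : Oct R) : (x - y).conj = x.conj - y.conj := by
  apply Oct.ext <;> simp [sub_eq_add_neg, add_comm]

theorem conj_neg (x : Oct R) : (-x).conj = -x.conj := by
  apply Oct.ext <;> simp

theorem conj_smul (r : R) (x : Oct R) : (r • x).conj = r • x.conj := by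
  apply Oct.ext <;> simp

theorem ip_add (x y z : Oct R) : x.ip (y + z) = x.ip y + x.ip z := by
  simp only [ip, re, conj_add, Oct.mul_add]; rfl

theorem ip_smul (r : R) (x y : Oct R) : x.ip (r • y) = r * x.ip y := by
  simp only [ip, re, conj_smul, Oct.mul_smul]; rfl

protected theorem one_mul (x : Oct R) : 1 * x = x := by
  apply Oct.ext <;> simp

protected theorem mul_one (x : Oct R) : x * 1 = x := by
  apply Oct.ext <;> simp

theorem conj_mul (x y : Oct R) : (x * y).conj = y.conj * x.conj := by
  apply Oct.ext <;> simp

theorem conj_conj (x : Oct R) : x.conj.conj = x := by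
  apply Oct.ext <;> simp

theorem mul_conj_add (x y : Oct R) : x * y.conj + y * x.conj = (2 * x.ip y) • 1 := by
  apply Oct.ext <;> ext <;> simp [ip, re] <;> ring

theorem conj_mul_add (x y : Oct R) : x.conj * y + y.conj * x = (2 * x.ip y) • 1 := by
  apply Oct.ext <;> ext <;> simp [ip, re] <;> ring

theorem toC_add (x y : Oct ℝ) : (x + y).toC = x.toC + y.toC := by
  apply Oct.ext <;> ext <;> simp

theorem toC_sub (x y : Oct ℝ) : (x - y).toC = x.toC - y.toC := by
  apply Oct.ext <;> ext <;> simp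

theorem toC_neg (x : Oct ℝ) : (-x).toC = -x.toC := by
  apply Oct.ext <;> ext <;> simp

theorem toC_smul (r : ℝ) (x : Oct ℝ) : (r • x).toC = (r : ℂ) • x.toC := by
  apply Oct.ext <;> ext <;> simp [-Complex.coe_smul]

theorem toC_conj (x : Oct ℝ) : x.conj.toC = x.toC.conj := by
  apply Oct.ext <;> ext <;> simp

theorem toC_mul (x y : Oct ℝ) : (x * y).toC = x.toC * y.toC := by
  apply Oct.ext <;> ext <;> simp

theorem ip_toC (x y : Oct ℝ) : x.toC.ip y.toC = (x.ip y : ℝ) := by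
  simp [ip, re]

end Lemmas

end Oct

/-! ### The exceptional Jordan algebra -/

/-- The underlying space of `𝒥¹`: the pair `(ξ, x)` stands for the Hermitian matrix
`h¹(ξ₁, ξ₂, ξ₃; x₁, x₂, x₃)`, see `toMatrix`.  The indices `1, 2, 3` are the elements `0, 1, 2` of
`Fin 3`, whose addition is the cyclic one. -/
abbrev J1 : Type := (Fin 3 → ℝ) × (Fin 3 → Oct ℝ)

/-- `h¹(a, b, c; x, y, z)`. -/
def h1 (a b c : ℝ) (x y z : Oct ℝ) : J1 := (![a, b, c], ![x, y, z])

/-- The matrix over the complexified octonions that an element of `𝒥¹` stands for. -/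
def toMatrix (X : J1) : Matrix (Fin 3) (Fin 3) (Oct ℂ) :=
  !![((X.1 0 : ℝ) : ℂ) • 1, Complex.I • (X.2 2).toC, Complex.I • (X.2 1).conj.toC;
     Complex.I • (X.2 2).conj.toC, ((X.1 1 : ℝ) : ℂ) • 1, (X.2 0).toC;
     Complex.I • (X.2 1).toC, (X.2 0).conj.toC, ((X.1 2 : ℝ) : ℂ) • 1]

/-- The signs `+, -, -` of the three off-diagonal positions. -/
def sgn : Fin 3 → ℝ := ![1, -1, -1]

/-- The Jordan product `X ∘ Y`, written out in the entries; `toMatrix_jmul` says that it is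
`(X Y + Y X) / 2`. -/
def jmul (X Y : J1) : J1 :=
  (fun i => X.1 i * Y.1 i + sgn (i + 1) * (X.2 (i + 1)).ip (Y.2 (i + 1))
      + sgn (i + 2) * (X.2 (i + 2)).ip (Y.2 (i + 2)),
   fun i => (1 / 2 : ℝ) • ((X.1 (i + 1) + X.1 (i + 2)) • Y.2 i + (Y.1 (i + 1) + Y.1 (i + 2)) • X.2 i
      - sgn i • (X.2 (i + 1) * Y.2 (i + 2) + Y.2 (i + 1) * X.2 (i + 2)).conj))

theorem toMatrix_jmul (X Y : J1) :
    toMatrix (jmul X Y) = (1 / 2 : ℂ) • (toMatrix X * toMatrix Y + toMatrix Y * toMatrix X) := by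
  have hI (c : Oct ℂ) : Complex.I • Complex.I • c = -c := by
    rw [smul_smul, Complex.I_mul_I, neg_smul, one_smul]
  have h1 (i : Fin 3) := Oct.mul_conj_add (X.2 i).toC (Y.2 i).toC
  have h2 (i : Fin 3) := Oct.conj_mul_add (X.2 i).toC (Y.2 i).toC
  simp only [Oct.ip_toC] at h1 h2
  have h1_0 := h1 0
  have h1_1 := h1 1
  have h1_2 := h1 2
  have h2_0 := h2 0
  have h2_1 := h2 1
  have h2_2 := h2 2
  ext i j
  rw [Matrix.smul_apply, Matrix.add_apply, Matrix.mul_apply, Matrix.mul_apply,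
    Fin.sum_univ_three, Fin.sum_univ_three]
  fin_cases i <;> fin_cases j <;>
    simp [toMatrix, jmul, sgn, Oct.toC_add, Oct.toC_sub, Oct.toC_smul, Oct.toC_conj, Oct.toC_mul,
      Oct.smul_mul, Oct.mul_smul, Oct.one_mul, Oct.mul_one, Oct.conj_add, Oct.conj_sub,
      Oct.toC_neg, Oct.conj_neg,
      Oct.conj_smul, Oct.conj_mul, Oct.conj_conj, hI, -Complex.real_smul, -Complex.coe_smul]
  · linear_combination (norm := module) (1 / 2 : ℂ) • h1_2 + (1 / 2 : ℂ) • h2_1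
  · module
  · module
  · module
  · linear_combination (norm := module) (1 / 2 : ℂ) • h2_2 - (1 / 2 : ℂ) • h1_0
  · module
  · module
  · module
  · linear_combination (norm := module) (1 / 2 : ℂ) • h1_1 - (1 / 2 : ℂ) • h2_0

/-- The trace. -/
def tr (X : J1) : ℝ := ∑ i, X.1 i

/-- The inner product `(X|Y) = tr (X ∘ Y)`. -/
def ip (X Y : J1) : ℝ := tr (jmul X Y)

/-- The unit element. -/
def E : J1 := h1 1 1 1 0 0 0

/-- The cross product `X × Y`. -/
def cross (X Y : J1) : J1 :=
  (1 / 2 : ℝ) • ((2 : ℝ) • jmul X Y - tr X • Y - tr Y • X + (tr X * tr Y - ip X Y) • E)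

/-- The diagonal idempotent `E₁`. -/
def E1 : J1 := h1 1 0 0 0 0 0

/-- `F₃¹(x)`. -/
def F3 (x : Oct ℝ) : J1 := h1 0 0 0 0 0 x

/-- `P⁻`. -/
def Pm : J1 := h1 (-1) 1 0 0 0 1

/-- `Q⁺(x)`. -/
def Qp (x : Oct ℝ) : J1 := h1 0 0 0 x x.conj 0

/-- `Q⁻(x)`. -/
def Qm (x : Oct ℝ) : J1 := h1 0 0 0 x (-x.conj) 0

/-! ### The group -/

/-- `F₄₍₋₂₀₎`, the automorphism group of `𝒥¹`, a closed subgroup of `GL(𝒥¹)` with the induced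
topology (`𝒥¹` is finite-dimensional, so all its linear endomorphisms are continuous). -/
def F4 : Subgroup (J1 →L[ℝ] J1)ˣ where
  carrier := {g | ∀ X Y, g.1 (jmul X Y) = jmul (g.1 X) (g.1 Y)}
  mul_mem' {a b} ha hb X Y := by
    simp only [Set.mem_ofPred_eq] at ha hb
    rw [Units.val_mul, mul_apply_eq_comp, hb, ha]
    rfl
  one_mem' X Y := rfl
  inv_mem' {a} ha X Y := by
    simp only [Set.mem_ofPred_eq] at ha
    have h (Z : J1) : a.1 (a⁻¹.1 Z) = Z := by
      rw [← mul_apply_eq_comp, ← Units.val_mul, mul_inv_cancel]; rfl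
    have h' (Z : J1) : a⁻¹.1 (a.1 Z) = Z := by
      rw [← mul_apply_eq_comp, ← Units.val_mul, inv_mul_cancel]; rfl
    rw [← h' (jmul (a⁻¹.1 X) (a⁻¹.1 Y)), ha, h, h]

/-- The endomorphism of `𝒥¹` given by an element of `F₄₍₋₂₀₎`. -/
def act (g : F4) : J1 →L[ℝ] J1 := g.1.1

/-- `σ = σ₁` as a linear map: it changes the signs of `x₂` and `x₃`. -/
def sigmaLin : J1 →L[ℝ] J1 :=
  LinearMap.toContinuousLinearMap
    { toFun := fun X => (X.1, ![X.2 0, -X.2 1, -X.2 2])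
      map_add' := fun X Y => by
        refine Prod.ext rfl (funext fun i => ?_)
        fin_cases i <;> simp [add_comm]
      map_smul' := fun r X => by
        refine Prod.ext rfl (funext fun i => ?_)
        fin_cases i <;> simp }

theorem sigmaLin_apply (X : J1) : sigmaLin X = (X.1, ![X.2 0, -X.2 1, -X.2 2]) := rfl

theorem sigmaLin_mul_self : sigmaLin * sigmaLin = 1 := by
  refine ContinuousLinearMap.ext fun X => ?_
  change sigmaLin (sigmaLin X) = X
  simp only [sigmaLin_apply]
  refine Prod.ext rfl (funext fun i => ?_)
  fin_cases i <;> simp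

theorem sigmaLin_jmul (X Y : J1) : sigmaLin (jmul X Y) = jmul (sigmaLin X) (sigmaLin Y) := by
  simp only [sigmaLin_apply]
  refine Prod.ext (funext fun i => ?_) (funext fun i => ?_)
  · fin_cases i <;> simp [jmul, Oct.ip, Oct.re]
  · fin_cases i <;> apply Oct.ext <;> simp [jmul, sgn] <;> module

/-- `σ` as an element of `F₄₍₋₂₀₎`. -/
def sigma : F4 :=
  ⟨⟨sigmaLin, sigmaLin, sigmaLin_mul_self, sigmaLin_mul_self⟩, sigmaLin_jmul⟩

/-! ### The Lie algebra elements -/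

/-- The derivation `Ã¹ᵢ(a)` of `𝒥¹`; it is `4 [L(Eᵢ₊₁), L(Fᵢ¹(a))]`, where `L(X)` is the
multiplication by `X`. -/
def Atilde (i : Fin 3) (a : Oct ℝ) : J1 →L[ℝ] J1 :=
  LinearMap.toContinuousLinearMap
    { toFun := fun X =>
        (fun j => if j = i then 0
          else if j = i + 1 then 2 * sgn i * a.ip (X.2 i) else -(2 * sgn i * a.ip (X.2 i)),
         fun j => if j = i then (X.1 (i + 2) - X.1 (i + 1)) • a
          else if j = i + 1 then sgn (i + 1) • (X.2 (i + 2) * a).conj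
          else -(sgn (i + 2) • (a * X.2 (i + 1)).conj))
      map_add' := fun X Y => by
        refine Prod.ext (funext fun j => ?_) (funext fun j => ?_)
        · by_cases h : j = i <;> by_cases h' : j = i + 1 <;> simp [h, h', Oct.ip_add] <;> ring
        · by_cases h : j = i <;> by_cases h' : j = i + 1 <;>
            simp [h, h', Oct.mul_add, Oct.add_mul, Oct.conj_add] <;> module
      map_smul' := fun r X => by
        refine Prod.ext (funext fun j => ?_) (funext fun j => ?_)
        · by_cases h : j = i <;> by_cases h' : j = i + 1 <;> simp [h, h', Oct.ip_smul] <;> ring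
        · by_cases h : j = i <;> by_cases h' : j = i + 1 <;>
            simp [h, h', Oct.mul_smul, Oct.smul_mul, Oct.conj_smul] <;> module }

/-- The derivation `δ(p)`, for purely imaginary `p`: it annihilates the diagonal and maps
`(x₁, x₂, x₃)` to `(p x₁, x₂ p, -(p x₃ + x₃ p))`. -/
def delta (p : Oct ℝ) : J1 →L[ℝ] J1 :=
  LinearMap.toContinuousLinearMap
    { toFun := fun X => (0, ![p * X.2 0, X.2 1 * p, -(p * X.2 2 + X.2 2 * p)])
      map_add' := fun X Y => by
        refine Prod.ext (by simp) (funext fun j => ?_)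
        fin_cases j <;> simp [Oct.mul_add, Oct.add_mul]
        abel
      map_smul' := fun r X => by
        refine Prod.ext (by simp) (funext fun j => ?_)
        fin_cases j <;> simp [Oct.mul_smul, Oct.smul_mul] }

/-- `𝒢₁(x)`. -/
def Gp1 (x : Oct ℝ) : J1 →L[ℝ] J1 := Atilde 0 x + Atilde 1 (-x.conj)

/-- `𝒢₋₁(x)`. -/
def Gm1 (x : Oct ℝ) : J1 →L[ℝ] J1 := Atilde 0 x + Atilde 1 x.conj

/-- `𝒢₂(p)`, for purely imaginary `p`. -/
def Gp2 (p : Oct ℝ) : J1 →L[ℝ] J1 := Atilde 2 (-p) - delta p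

/-- `𝒢₋₂(p)`, for purely imaginary `p`. -/
def Gm2 (p : Oct ℝ) : J1 →L[ℝ] J1 := Atilde 2 p - delta p

/-! ### The subgroups `K`, `M`, `A`, `N⁺`, `N⁻`, as sets -/

/-- The fixed points of `g ↦ σ g σ⁻¹`. -/
def K : Set F4 := {g | sigma * g * sigma⁻¹ = g}

/-- The centralizer of `Ã¹₃(1)` in `K`. -/
def M : Set F4 := {k | k ∈ K ∧ act k * Atilde 2 1 * act k⁻¹ = Atilde 2 1}

/-- The one-parameter group of the `exp (t Ã¹₃(1))`. -/
def A : Set F4 := {g | ∃ t : ℝ, act g = NormedSpace.exp (t • Atilde 2 1)}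

/-- `N⁺`. -/
def Np : Set F4 :=
  {g | ∃ x p : Oct ℝ, p.re = 0 ∧ act g = NormedSpace.exp (Gp1 x + Gp2 p)}

/-- `N⁻`. -/
def Nm : Set F4 :=
  {g | ∃ x p : Oct ℝ, p.re = 0 ∧ act g = NormedSpace.exp (Gm1 x + Gm2 p)}

/-! ### The null cone and its rays -/

/-- The exceptional null cone `𝒩₁⁻`. -/
def NullCone : Set J1 := {X | cross X X = 0 ∧ tr X = 0 ∧ ip E1 X < 0}

/-- `X ∼ Y` if `Y = r X` for some `r > 0`. -/
def raySetoid : Setoid NullCone where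
  r X Y := ∃ r : ℝ, 0 < r ∧ Y.1 = r • X.1
  iseqv :=
    { refl := fun X => ⟨1, one_pos, (one_smul ℝ X.1).symm⟩
      symm := fun {X Y} ⟨r, hr, h⟩ => ⟨r⁻¹, inv_pos.2 hr, by
        rw [h, smul_smul, inv_mul_cancel₀ hr.ne', one_smul]⟩
      trans := fun {X Y Z} ⟨r, hr, h⟩ ⟨s, hs, h'⟩ => ⟨s * r, mul_pos hs hr, by
        rw [h', h, smul_smul]⟩ }

/-- The space `ℱ` of rays in `𝒩₁⁻`. -/
def Rays : Type := Quotient raySetoid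

theorem sigma_Pm_mem : act sigma Pm ∈ NullCone := by
  have h : act sigma Pm = h1 (-1) 1 0 0 0 (-1) := by
    change sigmaLin Pm = _
    rw [sigmaLin_apply]
    refine Prod.ext rfl (funext fun i => ?_)
    fin_cases i <;> simp [Pm, h1]
  rw [h]
  refine ⟨?_, ?_, ?_⟩
  · refine Prod.ext (funext fun i => ?_) (funext fun i => ?_)
    · fin_cases i <;> simp [cross, tr, ip, jmul, h1, sgn, Oct.ip, Oct.re, E, Fin.sum_univ_three]
    · fin_cases i <;> apply Oct.ext <;>
        simp [cross, tr, ip, jmul, h1, sgn, Oct.ip, Oct.re, E, Fin.sum_univ_three]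
  · simp [tr, h1, Fin.sum_univ_three]
  · simp [ip, tr, jmul, E1, h1, sgn, Oct.ip, Oct.re, Fin.sum_univ_three]

/-- The class `[X]` of `X` in `ℱ`. -/
def ray (X : J1) (hX : X ∈ NullCone) : Rays := Quotient.mk raySetoid ⟨X, hX⟩

/-! ### The explicit factors -/

/-- The `N⁺`-factor `n_I(g)` of the Iwasawa decomposition `g = k a n`. -/
def nI (g : F4) : J1 →L[ℝ] J1 :=
  NormedSpace.exp
    (Gp1 ((1 / 2 * (ip (act g Pm) E1)⁻¹) • ∑ i : Fin 8, ip (act g (Qp (Oct.e i))) E1 • Oct.e i)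
      + Gp2 ((-(1 / 2) * (ip (act g Pm) E1)⁻¹) •
          ∑ i : Fin 7, ip (act g (F3 (Oct.e i.succ))) E1 • Oct.e i.succ))

/-- The factor `a_G(g)` of the Gauss decomposition. -/
def aG (g : F4) : J1 →L[ℝ] J1 :=
  NormedSpace.exp ((1 / 2 * Real.log (1 / 4 * ip (act g Pm) (act sigma Pm))) • Atilde 2 1)

/-- The factor `n⁻_G(g)` of the Gauss decomposition. -/
def nGm (g : F4) : J1 →L[ℝ] J1 :=
  NormedSpace.exp
    (Gm1 ((-(1 / 2) * (ip (act g Pm) (act sigma Pm))⁻¹) •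
          ∑ i : Fin 8, ip (Qm (Oct.e i)) (act g Pm) • Oct.e i)
      + Gm2 ((-(1 / 2) * (ip (act g Pm) (act sigma Pm))⁻¹) •
          ∑ i : Fin 7, ip (F3 (Oct.e i.succ)) (act g Pm) • Oct.e i.succ))

end Exceptional

end

open Exceptional

noncomputable section

namespace Exceptional

/-! ### Octonion identities: composition, alternativity, invariance of the inner product. -/

namespace Oct

/-! Everything is read off from the vector gP⁻. For the grading by Ã₃(1), P⁻ has weight 2: N⁺ and M
fix it and A scales it by exp(2t). Conversely, an automorphism that preserves the ray of P⁻ lies in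
MAN⁺ (`mem_MANp_iff`). The opposite vector σP⁻ is fixed by N⁻. Hence (gP⁻|σP⁻) equals 4 exp(2t) on
N⁻MAN⁺ and 0 on σMAN⁺.

That nothing else occurs is a statement about the null cone. There the pairing with σP⁻ is
nonnegative and vanishes only on the ray of σP⁻ (`ip_sigma_Pm_nonneg`, `eq_smul_sigma_Pm`). Where it
is positive, the vector is a positive multiple of nP⁻ for an explicit n in N⁻ (`eq_smul_exp_Gm_Pm`).
So N⁻ reaches every ray but one, which gives the Bruhat decomposition and the formula for the
N⁻-factor. Openness is continuity of the pairing. For density, a one-parameter subgroup of N⁺ moves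
σP⁻ off its ray (`exp_smul_Gp_sigma_Pm`).

The Iwasawa decomposition, needed for `mem_MANp_iff` and for the remaining Gauss factors, is proved
with E₁ as base point, since K is the stabilizer of E₁ (`mem_K_iff`). Automorphisms preserve the
trace, because tr L(X) = 9 tr X, and hence the inner product. The first entry of gE₁ is therefore
shown to be at least 1 (`one_le_act_E1`), so that (gP⁻|E₁) < 0 and its logarithm makes sense up to
sign. The pairings of g⁻¹E₁ with P⁻, Q⁺(y) and F₃(q) determine a and n, and after dividing these out
the same pairings force E₁ to be fixed (`act_E1_eq_of_ip`). -/

theorem ip_eq (x y : Oct ℝ) : x.ip y = x.1.re * y.1.re + x.1.imI * y.1.imI + x.1.imJ * y.1.imJ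
    + x.1.imK * y.1.imK + x.2.re * y.2.re + x.2.imI * y.2.imI + x.2.imJ * y.2.imJ
    + x.2.imK * y.2.imK := by
  simp [ip, re]; ring

theorem ext_coord {x y : Oct ℝ} (h0 : x.1.re = y.1.re) (h1 : x.1.imI = y.1.imI)
    (h2 : x.1.imJ = y.1.imJ) (h3 : x.1.imK = y.1.imK) (h4 : x.2.re = y.2.re)
    (h5 : x.2.imI = y.2.imI) (h6 : x.2.imJ = y.2.imJ) (h7 : x.2.imK = y.2.imK) : x = y :=
  Oct.ext (QuaternionAlgebra.ext h0 h1 h2 h3) (QuaternionAlgebra.ext h4 h5 h6 h7)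

set_option linter.unusedSimpArgs false in
-- Polarized form of x(x̄z) = |x|²z. Together with `ip_mul` this is the nonassociative input checked
-- in coordinates; the alternative laws and the composition property below are derived from it.
theorem mul_conj_mul_add (x y z : Oct ℝ) :
    x * (y.conj * z) + y * (x.conj * z) = (2 * x.ip y) • z := by
  apply ext_coord <;>
    simp only [fst_add, snd_add, fst_mul, snd_mul, fst_conj, snd_conj, fst_smul, snd_smul,
      Quaternion.re_add, Quaternion.imI_add, Quaternion.imJ_add, Quaternion.imK_add,
      Quaternion.re_sub, Quaternion.imI_sub, Quaternion.imJ_sub, Quaternion.imK_sub,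
      Quaternion.re_mul, Quaternion.imI_mul, Quaternion.imJ_mul, Quaternion.imK_mul,
      Quaternion.re_star, Quaternion.imI_star, Quaternion.imJ_star, Quaternion.imK_star,
      Quaternion.re_neg, Quaternion.imI_neg, Quaternion.imJ_neg, Quaternion.imK_neg,
      Quaternion.re_smul, Quaternion.imI_smul, Quaternion.imJ_smul, Quaternion.imK_smul,
      smul_eq_mul, ip_eq] <;> ring

theorem ip_comm (x y : Oct ℝ) : x.ip y = y.ip x := by
  simp only [ip_eq]; ring

theorem ip_add_left (x y z : Oct ℝ) : (x + y).ip z = x.ip z + y.ip z := by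
  rw [ip_comm, ip_add, ip_comm z, ip_comm z]

theorem ip_smul_left (r : ℝ) (x y : Oct ℝ) : (r • x).ip y = r * x.ip y := by
  rw [ip_comm, ip_smul, ip_comm]

theorem ip_neg (x y : Oct ℝ) : x.ip (-y) = -x.ip y := by
  rw [← neg_one_smul ℝ, ip_smul]; ring

theorem ip_neg_left (x y : Oct ℝ) : (-x).ip y = -x.ip y := by
  rw [ip_comm, ip_neg, ip_comm]

theorem ip_sub (x y z : Oct ℝ) : x.ip (y - z) = x.ip y - x.ip z := by
  rw [sub_eq_add_neg, ip_add, ip_neg, sub_eq_add_neg]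

theorem ip_sub_left (x y z : Oct ℝ) : (x - y).ip z = x.ip z - y.ip z := by
  rw [ip_comm, ip_sub, ip_comm z, ip_comm z]

@[simp] theorem ip_zero (x : Oct ℝ) : x.ip 0 = 0 := by simp [ip_eq]

@[simp] theorem zero_ip (x : Oct ℝ) : (0 : Oct ℝ).ip x = 0 := by simp [ip_eq]

theorem ip_conj (x y : Oct ℝ) : x.conj.ip y = x.ip y.conj := by
  simp [ip_eq]

theorem ip_self_nonneg (x : Oct ℝ) : 0 ≤ x.ip x := by
  simp only [ip_eq, ← sq]; positivity

theorem ip_self_eq_zero {x : Oct ℝ} : x.ip x = 0 ↔ x = 0 := by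
  refine ⟨fun h => ?_, fun h => by simp [h]⟩
  rw [ip_eq] at h
  apply ext_coord <;> simp only [fst_zero, snd_zero, Quaternion.re_zero, Quaternion.imI_zero,
    Quaternion.imJ_zero, Quaternion.imK_zero] <;> nlinarith only [h, mul_self_nonneg x.1.re,
      mul_self_nonneg x.1.imI, mul_self_nonneg x.1.imJ, mul_self_nonneg x.1.imK,
      mul_self_nonneg x.2.re, mul_self_nonneg x.2.imI, mul_self_nonneg x.2.imJ,
      mul_self_nonneg x.2.imK]

theorem one_ip (x : Oct ℝ) : (1 : Oct ℝ).ip x = x.re := by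
  simp [ip_eq, re]

protected theorem mul_zero (x : Oct ℝ) : x * 0 = 0 := by
  simpa using Oct.mul_smul (0 : ℝ) x 0

protected theorem zero_mul (x : Oct ℝ) : 0 * x = 0 := by
  simpa using Oct.smul_mul (0 : ℝ) 0 x

protected theorem mul_neg (x y : Oct ℝ) : x * -y = -(x * y) := by
  simpa using Oct.mul_smul (-1 : ℝ) x y

protected theorem neg_mul (x y : Oct ℝ) : -x * y = -(x * y) := by
  simpa using Oct.smul_mul (-1 : ℝ) x y

protected theorem mul_sub (x y z : Oct ℝ) : x * (y - z) = x * y - x * z := by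
  rw [sub_eq_add_neg, Oct.mul_add, Oct.mul_neg, sub_eq_add_neg]

protected theorem sub_mul (x y z : Oct ℝ) : (x - y) * z = x * z - y * z := by
  rw [sub_eq_add_neg, Oct.add_mul, Oct.neg_mul, sub_eq_add_neg]

@[simp] theorem conj_zero : (0 : Oct ℝ).conj = 0 := by
  apply Oct.ext <;> simp

@[simp] theorem conj_one : (1 : Oct ℝ).conj = 1 := by
  apply Oct.ext <;> simp

theorem conj_eq (x : Oct ℝ) : x.conj = (2 * x.re) • 1 - x := by
  apply ext_coord <;> simp [re]; ring

theorem mul_conj_mul_self (x z : Oct ℝ) : x * (x.conj * z) = x.ip x • z := by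
  linear_combination (norm := module) (1 / 2 : ℝ) • mul_conj_mul_add x x z

theorem ip_mul (x y z : Oct ℝ) : x.ip (y * z) = z.ip (y.conj * x) := by
  simp only [ip_eq, fst_mul, snd_mul, Quaternion.re_add, Quaternion.imI_add, Quaternion.imJ_add,
    Quaternion.imK_add, Quaternion.re_sub, Quaternion.imI_sub, Quaternion.imJ_sub,
    Quaternion.imK_sub, Quaternion.re_mul, Quaternion.imI_mul, Quaternion.imJ_mul,
    Quaternion.imK_mul, Quaternion.re_star, Quaternion.imI_star, Quaternion.imJ_star,
    Quaternion.imK_star, Quaternion.re_neg, Quaternion.imI_neg, Quaternion.imJ_neg,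
    Quaternion.imK_neg, fst_conj, snd_conj]
  ring

theorem mul_conj_add_mul_conj (x y z : Oct ℝ) :
    (z * y.conj) * x + (z * x.conj) * y = (2 * x.ip y) • z := by
  have h := congrArg conj (mul_conj_mul_add x.conj y.conj z.conj)
  simpa only [conj_add, conj_mul, conj_conj, conj_smul, ip_conj] using h

/-- The trilinear form Re(xyz) is invariant under cyclic shifts; this is what makes the three
off-diagonal positions interchangeable. -/
theorem ip_conj_mul_cyclic (x y z : Oct ℝ) : x.ip (y * z).conj = y.ip (z * x).conj := by
  rw [conj_mul, ip_mul, conj_conj, ip_conj]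

theorem conj_mul_mul_add (x y z : Oct ℝ) :
    x.conj * (y * z) + y.conj * (x * z) = (2 * x.ip y) • z := by
  simpa only [conj_conj, ip_conj] using mul_conj_mul_add x.conj y.conj z

theorem mul_mul_conj_add (x y z : Oct ℝ) :
    (z * x) * y.conj + (z * y) * x.conj = (2 * x.ip y) • z := by
  have h := mul_conj_add_mul_conj x.conj y.conj z
  rw [add_comm]
  simpa only [conj_conj, ip_conj] using h

/-- The linearized left alternative law, obtained from the composition identity by substituting x̄ =
2 Re x - x. -/
theorem mul_add_mul_mul (x y z : Oct ℝ) :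
    (x * y) * z + (y * x) * z = x * (y * z) + y * (x * z) := by
  have h1 := conj_mul_mul_add x y z
  have h2 := congrArg (· * z) (conj_mul_add x y)
  simp only [conj_eq, Oct.sub_mul, Oct.smul_mul, Oct.one_mul, Oct.add_mul] at h1 h2
  linear_combination (norm := module) h1 - h2

theorem mul_mul_add_mul (x y z : Oct ℝ) :
    z * (x * y) + z * (y * x) = (z * x) * y + (z * y) * x := by
  have h := congrArg conj (mul_add_mul_mul y.conj x.conj z.conj)
  simp only [conj_add, conj_mul, conj_conj] at h
  linear_combination (norm := module) h

end Oct

/-! ### Derivations -/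

theorem Atilde_apply (i : Fin 3) (a : Oct ℝ) (X : J1) : Atilde i a X = (fun j => if j = i then 0
          else if j = i + 1 then 2 * sgn i * a.ip (X.2 i) else -(2 * sgn i * a.ip (X.2 i)),
         fun j => if j = i then (X.1 (i + 2) - X.1 (i + 1)) • a
          else if j = i + 1 then sgn (i + 1) • (X.2 (i + 2) * a).conj
          else -(sgn (i + 2) • (a * X.2 (i + 1)).conj)) := rfl

set_option linter.unusedSimpArgs false in
set_option maxHeartbeats 4000000 in
-- On the diagonal entries the Leibniz rule reduces to cyclicity of the trilinear form, on the
-- off-diagonal ones to the polarized composition identities.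
theorem Atilde_jmul (i : Fin 3) (a : Oct ℝ) (X Y : J1) :
    Atilde i a (jmul X Y) = jmul (Atilde i a X) Y + jmul X (Atilde i a Y) := by
  refine Prod.ext (funext fun j => ?_) (funext fun j => ?_)
  · have h1 := Oct.ip_conj_mul_cyclic a (X.2 (i + 1)) (Y.2 (i + 2))
    have h2 := Oct.ip_conj_mul_cyclic a (Y.2 (i + 1)) (X.2 (i + 2))
    have h3 := Oct.ip_conj_mul_cyclic (X.2 (i + 1)) (Y.2 (i + 2)) a
    have h4 := Oct.ip_conj_mul_cyclic (Y.2 (i + 1)) (X.2 (i + 2)) a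
    have h5 := Oct.ip_comm (Y.2 (i + 1)) (X.2 (i + 2) * a).conj
    have h6 := Oct.ip_comm (Y.2 (i + 2)) (a * X.2 (i + 1)).conj
    fin_cases i <;> fin_cases j <;>
      simp [Atilde_apply, jmul, sgn, Oct.ip_add, Oct.ip_smul, Oct.ip_neg, Oct.ip_neg_left,
        Oct.ip_smul_left, Oct.conj_add, Oct.conj_smul, Oct.ip_sub] at h1 h2 h3 h4 h5 h6 ⊢ <;>
      try simp only [Oct.ip_comm _ a]
    all_goals linarith
  · have h1 := Oct.conj_mul_mul_add (X.2 (i + 2)) (Y.2 (i + 2)) a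
    have h2 := Oct.mul_mul_conj_add (X.2 (i + 1)) (Y.2 (i + 1)) a
    have h3 := Oct.conj_mul_mul_add a (X.2 i) (Y.2 (i + 1))
    have h4 := Oct.conj_mul_mul_add a (Y.2 i) (X.2 (i + 1))
    have h5 := Oct.mul_mul_conj_add a (X.2 i) (Y.2 (i + 2))
    have h6 := Oct.mul_mul_conj_add a (Y.2 i) (X.2 (i + 2))
    fin_cases i <;> fin_cases j <;>
      simp [Atilde_apply, jmul, sgn, Oct.mul_add, Oct.add_mul, Oct.mul_smul, Oct.smul_mul,
        Oct.conj_add, Oct.conj_mul, Oct.conj_neg, Oct.conj_smul, Oct.conj_conj, Oct.mul_neg,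
        Oct.neg_mul, Oct.mul_sub, Oct.sub_mul, Oct.conj_sub] at h1 h2 h3 h4 h5 h6 ⊢
    all_goals first
      | linear_combination (norm := module) (-1 / 2 : ℝ) • h1 + (1 / 2 : ℝ) • h2
      | linear_combination (norm := module) (-1 / 2 : ℝ) • h1 + (-1 / 2 : ℝ) • h2
      | linear_combination (norm := module) (1 / 2 : ℝ) • h1 + (1 / 2 : ℝ) • h2
      | linear_combination (norm := module) (-1 / 2 : ℝ) • h3 + (-1 / 2 : ℝ) • h4
      | linear_combination (norm := module) (1 / 2 : ℝ) • h3 + (1 / 2 : ℝ) • h4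
      | linear_combination (norm := module) (-1 / 2 : ℝ) • h5 + (-1 / 2 : ℝ) • h6
      | linear_combination (norm := module) (1 / 2 : ℝ) • h5 + (1 / 2 : ℝ) • h6

theorem delta_apply (p : Oct ℝ) (X : J1) :
    delta p X = (0, ![p * X.2 0, X.2 1 * p, -(p * X.2 2 + X.2 2 * p)]) := rfl

set_option linter.unusedSimpArgs false in
set_option maxHeartbeats 4000000 in
-- An instance of infinitesimal triality. The diagonal entries use that multiplication by an
-- imaginary p, on either side, is skew; the off-diagonal ones use the linearized alternative laws.
theorem delta_jmul {p : Oct ℝ} (hp : p.re = 0) (X Y : J1) :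
    delta p (jmul X Y) = jmul (delta p X) Y + jmul X (delta p Y) := by
  have hc : p.conj = -p := by rw [Oct.conj_eq, hp]; simp
  have hl (x y : Oct ℝ) : (p * x).ip y = - x.ip (p * y) := by
    rw [Oct.ip_comm, Oct.ip_mul, hc, Oct.neg_mul, Oct.ip_neg]
  have hr (x y : Oct ℝ) : (x * p).ip y = - x.ip (y * p) := by
    have := hl x.conj y.conj
    rw [← Oct.conj_conj (x * p), ← Oct.conj_conj (y * p), ← Oct.ip_conj x, Oct.ip_conj (x * p).conj,
      Oct.conj_mul, Oct.conj_mul, hc, Oct.neg_mul, Oct.neg_mul, Oct.ip_neg_left, Oct.ip_neg, this]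
  refine Prod.ext (funext fun j => ?_) (funext fun j => ?_)
  · fin_cases j <;> simp [delta_apply, jmul, sgn, Oct.ip_add, Oct.ip_neg, Oct.ip_neg_left,
    Oct.ip_add_left, hl, hr] <;> ring
  · fin_cases j
    · have h1 := congrArg Oct.conj (Oct.mul_mul_add_mul p (Y.2 2) (X.2 1))
      have h2 := congrArg Oct.conj (Oct.mul_mul_add_mul p (X.2 2) (Y.2 1))
      simp [delta_apply, jmul, sgn, Oct.mul_add, Oct.add_mul, Oct.mul_smul, Oct.smul_mul,
        Oct.conj_add, Oct.conj_mul, Oct.conj_neg, Oct.conj_smul, Oct.conj_conj, Oct.mul_neg,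
        Oct.neg_mul, Oct.mul_sub, Oct.sub_mul, Oct.conj_sub, hc] at h1 h2 ⊢
      linear_combination (norm := module) (-1 / 2 : ℝ) • h1 + (-1 / 2 : ℝ) • h2
    · have h1 := congrArg Oct.conj (Oct.mul_add_mul_mul p (X.2 2) (Y.2 0))
      have h2 := congrArg Oct.conj (Oct.mul_add_mul_mul p (Y.2 2) (X.2 0))
      simp [delta_apply, jmul, sgn, Oct.mul_add, Oct.add_mul, Oct.mul_smul, Oct.smul_mul,
        Oct.conj_add, Oct.conj_mul, Oct.conj_neg, Oct.conj_smul, Oct.conj_conj, Oct.mul_neg,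
        Oct.neg_mul, Oct.mul_sub, Oct.sub_mul, Oct.conj_sub, hc] at h1 h2 ⊢
      linear_combination (norm := module) (1 / 2 : ℝ) • h1 + (1 / 2 : ℝ) • h2
    · have h1 := congrArg Oct.conj (Oct.mul_mul_add_mul p (Y.2 1) (X.2 0))
      have h2 := congrArg Oct.conj (Oct.mul_add_mul_mul (X.2 0) p (Y.2 1))
      have h3 := congrArg Oct.conj (Oct.mul_mul_add_mul p (X.2 1) (Y.2 0))
      have h4 := congrArg Oct.conj (Oct.mul_add_mul_mul (Y.2 0) p (X.2 1))
      simp [delta_apply, jmul, sgn, Oct.mul_add, Oct.add_mul, Oct.mul_smul, Oct.smul_mul,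
        Oct.conj_add, Oct.conj_mul, Oct.conj_neg, Oct.conj_smul, Oct.conj_conj, Oct.mul_neg,
        Oct.neg_mul, Oct.mul_sub, Oct.sub_mul, Oct.conj_sub, hc] at h1 h2 h3 h4 ⊢
      linear_combination (norm := module) (-1 / 2 : ℝ) • h1 + (-1 / 2 : ℝ) • h2 + (-1 / 2 : ℝ) • h3
        + (-1 / 2 : ℝ) • h4

/-! ### Exponentials of endomorphisms -/

section Exp

variable {V : Type*} [NormedAddCommGroup V] [NormedSpace ℝ V] [CompleteSpace V]

theorem hasSum_exp_apply (D : V →L[ℝ] V) (v : V) :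
    HasSum (fun n : ℕ => ((n.factorial : ℝ)⁻¹) • (D ^ n) v) (NormedSpace.exp D v) := by
  have h := NormedSpace.exp_series_hasSum_exp' (𝕂 := ℝ) D
  exact h.mapL (ContinuousLinearMap.apply ℝ V v)

theorem exp_apply_of_pow_apply_eq_zero {D : V →L[ℝ] V} {v : V} {n : ℕ} (h : (D ^ n) v = 0) :
    NormedSpace.exp D v = ∑ i ∈ Finset.range n, ((i.factorial : ℝ)⁻¹) • (D ^ i) v := by
  refine (hasSum_exp_apply D v).unique (hasSum_sum_of_ne_finset_zero fun m hm => ?_)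
  obtain ⟨k, rfl⟩ := Nat.exists_eq_add_of_le' (not_lt.1 fun hlt => hm (Finset.mem_range.2 hlt))
  rw [pow_add, mul_apply_eq_comp, h, map_zero, smul_zero]

theorem exp_apply_of_apply_eq_smul {D : V →L[ℝ] V} {v : V} {c : ℝ} (h : D v = c • v) :
    NormedSpace.exp D v = Real.exp c • v := by
  have hpow (n : ℕ) : (D ^ n) v = c ^ n • v := by
    induction n with
    | zero => simp
    | succ n ih => rw [pow_succ, mul_apply_eq_comp, h, map_smul, ih, smul_smul, pow_succ']
  refine (hasSum_exp_apply D v).unique ?_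
  rw [Real.exp_eq_exp_ℝ]
  simp only [hpow, smul_smul]
  have h := NormedSpace.exp_series_hasSum_exp' (𝕂 := ℝ) c
  simpa using h.smul_const v

theorem exp_apply_of_apply_eq_zero {D : V →L[ℝ] V} {v : V} (h : D v = 0) :
    NormedSpace.exp D v = v := by
  simpa using exp_apply_of_apply_eq_smul (c := 0) (by simpa using h)

theorem exp_mul_exp_neg (D : V →L[ℝ] V) : NormedSpace.exp D * NormedSpace.exp (-D) = 1 := by
  let +nondep : NormedAlgebra ℚ (V →L[ℝ] V) := .restrictScalars ℚ ℝ _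
  rw [← NormedSpace.exp_add_of_commute (Commute.neg_right (Commute.refl D)), add_neg_cancel,
    NormedSpace.exp_zero]

/-- The exponential of an endomorphism as a unit. -/
def expUnit (D : V →L[ℝ] V) : (V →L[ℝ] V)ˣ :=
  ⟨NormedSpace.exp D, NormedSpace.exp (-D), exp_mul_exp_neg D, by
    simpa using exp_mul_exp_neg (-D)⟩

theorem continuous_expUnit : Continuous (expUnit : (V →L[ℝ] V) → (V →L[ℝ] V)ˣ) := by
  let +nondep : NormedAlgebra ℚ (V →L[ℝ] V) := .restrictScalars ℚ ℝ _
  exact Units.continuous_iff.2 ⟨NormedSpace.exp_continuous,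
    NormedSpace.exp_continuous.comp continuous_neg⟩

/-- The exponential of a derivation of a bilinear product is multiplicative. -/
theorem exp_apply_bilin (B : V →L[ℝ] V →L[ℝ] V) {D : V →L[ℝ] V}
    (hD : ∀ u v, D (B u v) = B (D u) v + B u (D v)) (u v : V) :
    NormedSpace.exp D (B u v) = B (NormedSpace.exp D u) (NormedSpace.exp D v) := by
  have hd (w : V) (t : ℝ) : HasDerivAt (fun s : ℝ => NormedSpace.exp (s • D) w)
      (D (NormedSpace.exp (t • D) w)) t := by
    have h := (hasDerivAt_exp_smul_const' D t).clm_apply (hasDerivAt_const t w)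
    simpa using h
  -- Pull the product back by exp(-sD). By the Leibniz rule the result is constant in s, and
  -- comparing s = 1 with s = 0 gives the claim.
  have hφ (t : ℝ) : HasDerivAt (fun s : ℝ => NormedSpace.exp (s • (-D))
      (B (NormedSpace.exp (s • D) u) (NormedSpace.exp (s • D) v))) 0 t := by
    have hB := B.hasDerivAt_of_bilinear (fun _ => hd u t) (fun _ => hd v t)
    refine ((hasDerivAt_exp_smul_const (-D) t).clm_apply hB).congr_deriv ?_
    rw [mul_apply_eq_comp, ← map_add]
    simp only [neg_apply, hD, map_neg, map_add]
    abel
  have hc := is_const_of_deriv_eq_zero (fun t => (hφ t).differentiableAt)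
    (fun t => (hφ t).deriv) 1 0
  simp only [one_smul, zero_smul, NormedSpace.exp_zero] at hc
  have h1 := congrArg (fun w => NormedSpace.exp D w) hc
  beta_reduce at h1
  rw [← mul_apply_eq_comp, exp_mul_exp_neg] at h1
  exact h1.symm

end Exp

/-! ### Bilinearity of the product -/

theorem jmul_add (X Y Z : J1) : jmul X (Y + Z) = jmul X Y + jmul X Z := by
  refine Prod.ext (funext fun i => ?_) (funext fun i => ?_)
  · simp [jmul, Oct.ip_add]; ring
  · simp [jmul, Oct.mul_add, Oct.add_mul, Oct.conj_add]; module

theorem jmul_smul (r : ℝ) (X Y : J1) : jmul X (r • Y) = r • jmul X Y := by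
  refine Prod.ext (funext fun i => ?_) (funext fun i => ?_)
  · simp [jmul, Oct.ip_smul]; ring
  · simp [jmul, Oct.mul_smul, Oct.smul_mul, Oct.conj_add, Oct.conj_smul]; module

theorem jmul_comm (X Y : J1) : jmul X Y = jmul Y X := by
  refine Prod.ext (funext fun i => ?_) (funext fun i => ?_)
  · simp [jmul, Oct.ip_comm (X.2 _), mul_comm (X.1 i)]
  · simp [jmul, Oct.conj_add]; module

/-- The Jordan product as a bilinear map. -/
def jmulₗ : J1 →ₗ[ℝ] J1 →ₗ[ℝ] J1 :=
  LinearMap.mk₂ ℝ jmul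
    (fun X Y Z => by rw [jmul_comm, jmul_add, jmul_comm Z, jmul_comm Z])
    (fun r X Y => by rw [jmul_comm, jmul_smul, jmul_comm Y])
    jmul_add (fun r X Y => jmul_smul r X Y)

theorem jmulₗ_apply (X Y : J1) : jmulₗ X Y = jmul X Y := rfl

theorem add_jmul (X Y Z : J1) : jmul (X + Y) Z = jmul X Z + jmul Y Z := jmulₗ.map_add₂ X Y Z

theorem smul_jmul (r : ℝ) (X Y : J1) : jmul (r • X) Y = r • jmul X Y := jmulₗ.map_smul₂ r X Y

theorem tr_add (X Y : J1) : tr (X + Y) = tr X + tr Y := by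
  simp [tr, Finset.sum_add_distrib]

theorem tr_smul (r : ℝ) (X : J1) : tr (r • X) = r * tr X := by
  simp [tr, Finset.mul_sum]

theorem ip_comm (X Y : J1) : ip X Y = ip Y X := by rw [ip, jmul_comm, ip]

theorem ip_add (X Y Z : J1) : ip X (Y + Z) = ip X Y + ip X Z := by
  rw [ip, jmul_add, tr_add, ip, ip]

theorem ip_smul (r : ℝ) (X Y : J1) : ip X (r • Y) = r * ip X Y := by
  rw [ip, jmul_smul, tr_smul, ip]

theorem ip_smul_left (r : ℝ) (X Y : J1) : ip (r • X) Y = r * ip X Y := by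
  rw [ip_comm, ip_smul, ip_comm]

theorem ip_add_left (X Y Z : J1) : ip (X + Y) Z = ip X Z + ip Y Z := by
  rw [ip_comm, ip_add, ip_comm Z, ip_comm Z]

theorem ip_eq (X Y : J1) : ip X Y = X.1 0 * Y.1 0 + X.1 1 * Y.1 1 + X.1 2 * Y.1 2
    + 2 * (X.2 0).ip (Y.2 0) - 2 * (X.2 1).ip (Y.2 1) - 2 * (X.2 2).ip (Y.2 2) := by
  simp [ip, tr, jmul, Fin.sum_univ_three, sgn]; ring

/-! ### Automorphisms -/

theorem act_jmul (g : F4) (X Y : J1) : act g (jmul X Y) = jmul (act g X) (act g Y) := g.2 X Y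

theorem act_mul (g h : F4) : act (g * h) = act g * act h := rfl

theorem act_mul_apply (g h : F4) (X : J1) : act (g * h) X = act g (act h X) := rfl

theorem act_one (X : J1) : act 1 X = X := rfl

theorem act_inv_act (g : F4) (X : J1) : act g⁻¹ (act g X) = X := by
  rw [← act_mul_apply, inv_mul_cancel, act_one]

theorem act_act_inv (g : F4) (X : J1) : act g (act g⁻¹ X) = X := by
  rw [← act_mul_apply, mul_inv_cancel, act_one]

theorem act_injective : Function.Injective act := fun _ _ h => Subtype.ext (Units.ext h)

/-- The derivations of `𝒥¹`. -/
def IsDerivation (D : J1 →L[ℝ] J1) : Prop :=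
  ∀ X Y, D (jmul X Y) = jmul (D X) Y + jmul X (D Y)

namespace IsDerivation

theorem add {D D' : J1 →L[ℝ] J1} (h : IsDerivation D) (h' : IsDerivation D') :
    IsDerivation (D + D') := fun X Y => by
  simp only [add_apply, h X Y, h' X Y, add_jmul, jmul_add]; abel

theorem smul {D : J1 →L[ℝ] J1} (h : IsDerivation D) (r : ℝ) : IsDerivation (r • D) :=
  fun X Y => by simp only [smul_apply, h X Y, smul_jmul, jmul_smul, smul_add]

theorem sub {D D' : J1 →L[ℝ] J1} (h : IsDerivation D) (h' : IsDerivation D') :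
    IsDerivation (D - D') := by
  rw [sub_eq_add_neg, ← neg_one_smul ℝ D']
  exact h.add (h'.smul _)

theorem Gp {p : Oct ℝ} (x : Oct ℝ) (hp : p.re = 0) : IsDerivation (Gp1 x + Gp2 p) :=
  .add (.add (Atilde_jmul _ _) (Atilde_jmul _ _)) (.sub (Atilde_jmul _ _) (delta_jmul hp))

theorem Gm {p : Oct ℝ} (x : Oct ℝ) (hp : p.re = 0) : IsDerivation (Gm1 x + Gm2 p) :=
  .add (.add (Atilde_jmul _ _) (Atilde_jmul _ _)) (.sub (Atilde_jmul _ _) (delta_jmul hp))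

theorem Atilde_two_one (t : ℝ) : IsDerivation (t • Atilde 2 1) :=
  .smul (Atilde_jmul _ _) t

end IsDerivation

/-- The exponential of a derivation, an automorphism. -/
def expDer (D : J1 →L[ℝ] J1) (hD : IsDerivation D) : F4 :=
  ⟨expUnit D, exp_apply_bilin jmulₗ.toContinuousBilinearMap hD⟩

theorem act_inv_of_act_eq_exp {g : F4} {D : J1 →L[ℝ] J1} (h : act g = NormedSpace.exp D) :
    act g⁻¹ = NormedSpace.exp (-D) := by
  have h1 : act g⁻¹ * act g = 1 := by rw [← act_mul, inv_mul_cancel]; rfl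
  calc act g⁻¹ = act g⁻¹ * (act g * NormedSpace.exp (-D)) := by
        rw [h, exp_mul_exp_neg, mul_one]
    _ = NormedSpace.exp (-D) := by rw [← mul_assoc, h1, one_mul]

/-! ### Invariance of the trace -/

/-- The coordinates of an octonion. -/
def Oct.coordEquiv : Oct ℝ ≃ₗ[ℝ] (Fin 8 → ℝ) where
  toFun x := ![x.1.re, x.1.imI, x.1.imJ, x.1.imK, x.2.re, x.2.imI, x.2.imJ, x.2.imK]
  invFun c := (⟨c 0, c 1, c 2, c 3⟩, ⟨c 4, c 5, c 6, c 7⟩)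
  map_add' x y := by ext i; fin_cases i <;> rfl
  map_smul' r x := by ext i; fin_cases i <;> rfl
  left_inv x := rfl
  right_inv c := by ext i; fin_cases i <;> rfl

/-- This expresses the trace form through the Jordan product alone, so that automorphisms preserve
it. The diagonal coordinates contribute tr X, and the 8 coordinates of each octonion entry
contribute the mean of two diagonal entries, in total 8 tr X. -/
theorem trace_jmulₗ (X : J1) : LinearMap.trace ℝ J1 (jmulₗ X) = 9 * tr X := by
  let b := (Pi.basisFun ℝ (Fin 3)).prod
    (Pi.basis fun _ : Fin 3 => Module.Basis.ofEquivFun Oct.coordEquiv)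
  rw [LinearMap.trace_eq_matrix_trace ℝ b]
  have h (j : Fin 3) (k : Fin 8) : (LinearMap.toMatrix b b (jmulₗ X)) (Sum.inr ⟨j, k⟩)
      (Sum.inr ⟨j, k⟩) = (X.1 (j + 1) + X.1 (j + 2)) / 2 := by
    rw [LinearMap.toMatrix_apply]
    fin_cases j <;> simp [b, jmulₗ_apply, jmul, Oct.mul_zero, Oct.zero_mul] <;> ring
  have h' (j : Fin 3) : (LinearMap.toMatrix b b (jmulₗ X)) (Sum.inl j) (Sum.inl j) = X.1 j := by
    rw [LinearMap.toMatrix_apply]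
    simp [b, jmulₗ_apply, jmul]
  simp only [Matrix.trace, Matrix.diag, Fintype.sum_sum_type, Fintype.sum_sigma, h, h', tr,
    Fin.sum_univ_three]
  simp
  ring

theorem tr_act (g : F4) (X : J1) : tr (act g X) = tr X := by
  have h : jmulₗ (act g X) =
      (act g : J1 →ₗ[ℝ] J1) * (jmulₗ X * (act g⁻¹ : J1 →ₗ[ℝ] J1)) := by
    refine LinearMap.ext fun Y => ?_
    change jmul (act g X) Y = act g (jmul X (act g⁻¹ Y))
    rw [act_jmul, act_act_inv]
  have h' : (act g⁻¹ : J1 →ₗ[ℝ] J1) * (act g : J1 →ₗ[ℝ] J1) = 1 :=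
    LinearMap.ext fun Y => act_inv_act g Y
  have ht := congrArg (LinearMap.trace ℝ J1) h
  rw [LinearMap.trace_mul_comm, mul_assoc, h', mul_one, trace_jmulₗ, trace_jmulₗ] at ht
  linarith

theorem ip_act (g : F4) (X Y : J1) : ip (act g X) (act g Y) = ip X Y := by
  rw [ip, ← act_jmul, tr_act, ip]

theorem ip_act_left (g : F4) (X Y : J1) : ip (act g X) Y = ip X (act g⁻¹ Y) := by
  rw [← ip_act g X, act_act_inv]

/-! ### Explicit actions of the derivations -/

theorem eq_h1 (X : J1) : X = h1 (X.1 0) (X.1 1) (X.1 2) (X.2 0) (X.2 1) (X.2 2) := by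
  refine Prod.ext (funext fun i => ?_) (funext fun i => ?_) <;> fin_cases i <;> rfl

theorem h1_congr {a b c a' b' c' : ℝ} {x y z x' y' z' : Oct ℝ} (ha : a = a') (hb : b = b')
    (hc : c = c') (hx : x = x') (hy : y = y') (hz : z = z') :
    h1 a b c x y z = h1 a' b' c' x' y' z' := by
  subst ha hb hc hx hy hz; rfl

theorem h1_add (a b c a' b' c' : ℝ) (x y z x' y' z' : Oct ℝ) :
    h1 a b c x y z + h1 a' b' c' x' y' z' =
      h1 (a + a') (b + b') (c + c') (x + x') (y + y') (z + z') := by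
  simp [h1]

theorem h1_smul (r a b c : ℝ) (x y z : Oct ℝ) :
    r • h1 a b c x y z = h1 (r * a) (r * b) (r * c) (r • x) (r • y) (r • z) := by
  simp [h1]

theorem h1_sub (a b c a' b' c' : ℝ) (x y z x' y' z' : Oct ℝ) :
    h1 a b c x y z - h1 a' b' c' x' y' z' =
      h1 (a - a') (b - b') (c - c') (x - x') (y - y') (z - z') := by
  simp [h1]

theorem h1_zero : h1 0 0 0 0 0 0 = 0 := by
  simp [h1]

theorem ip_h1 (a b c a' b' c' : ℝ) (x y z x' y' z' : Oct ℝ) :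
    ip (h1 a b c x y z) (h1 a' b' c' x' y' z') =
      a * a' + b * b' + c * c' + 2 * x.ip x' - 2 * y.ip y' - 2 * z.ip z' := ip_eq _ _

theorem Atilde_zero_h1 (u : Oct ℝ) (a b c : ℝ) (x y z : Oct ℝ) :
    Atilde 0 u (h1 a b c x y z) = h1 0 (2 * u.ip x) (-(2 * u.ip x)) ((c - b) • u)
      (-(z * u).conj) (u * y).conj := by
  refine Prod.ext (funext fun i => ?_) (funext fun i => ?_) <;> fin_cases i <;>
    simp [Atilde_apply, h1, sgn]

theorem Atilde_one_h1 (u : Oct ℝ) (a b c : ℝ) (x y z : Oct ℝ) :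
    Atilde 1 u (h1 a b c x y z) = h1 (2 * u.ip y) 0 (-(2 * u.ip y)) (-(u * z).conj)
      ((a - c) • u) (-(x * u).conj) := by
  refine Prod.ext (funext fun i => ?_) (funext fun i => ?_) <;> fin_cases i <;>
    simp [Atilde_apply, h1, sgn]

theorem Atilde_two_h1 (u : Oct ℝ) (a b c : ℝ) (x y z : Oct ℝ) :
    Atilde 2 u (h1 a b c x y z) = h1 (-(2 * u.ip z)) (2 * u.ip z) 0 (y * u).conj
      (u * x).conj ((b - a) • u) := by
  refine Prod.ext (funext fun i => ?_) (funext fun i => ?_) <;> fin_cases i <;>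
    simp [Atilde_apply, h1, sgn]

theorem delta_h1 (p : Oct ℝ) (a b c : ℝ) (x y z : Oct ℝ) :
    delta p (h1 a b c x y z) = h1 0 0 0 (p * x) (y * p) (-(p * z + z * p)) := by
  refine Prod.ext (funext fun i => ?_) (funext fun i => ?_) <;> fin_cases i <;>
    simp [delta_apply, h1]

theorem sigma_h1 (a b c : ℝ) (x y z : Oct ℝ) :
    act sigma (h1 a b c x y z) = h1 a b c x (-y) (-z) := rfl

theorem sigma_Pm : act sigma Pm = h1 (-1) 1 0 0 0 (-1) := by
  rw [Pm, sigma_h1, neg_zero]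

theorem Oct.conj_of_re_eq_zero {p : Oct ℝ} (hp : p.re = 0) : p.conj = -p := by
  rw [Oct.conj_eq, hp]; simp

theorem Gp_h1 {x p : Oct ℝ} (hp : p.re = 0) (a b c : ℝ) (u v w : Oct ℝ) :
    (Gp1 x + Gp2 p) (h1 a b c u v w) =
      h1 (-(2 * x.ip v.conj) + 2 * p.ip w) (2 * x.ip u - 2 * p.ip w)
        (-(2 * x.ip u) + 2 * x.ip v.conj)
        ((c - b) • x + w.conj * x + p * v.conj - p * u)
        (-(x.conj * w.conj) - (a - c) • x.conj + u.conj * p - v * p)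
        (v.conj * x.conj + x * u.conj - (b - a) • p + (p * w + w * p)) := by
  simp only [Gp1, Gp2, add_apply, sub_apply, Atilde_zero_h1, Atilde_one_h1, Atilde_two_h1,
    delta_h1, h1_sub, h1_add]
  apply h1_congr <;> try simp only [Oct.ip_neg_left, Oct.ip_conj, Oct.conj_mul, Oct.conj_neg,
    Oct.conj_of_re_eq_zero hp, Oct.conj_conj, Oct.neg_mul, Oct.mul_neg]
  any_goals ring1
  all_goals module

theorem Gm_h1 {x p : Oct ℝ} (hp : p.re = 0) (a b c : ℝ) (u v w : Oct ℝ) :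
    (Gm1 x + Gm2 p) (h1 a b c u v w) =
      h1 (2 * x.ip v.conj - 2 * p.ip w) (2 * x.ip u + 2 * p.ip w)
        (-(2 * x.ip u) - 2 * x.ip v.conj)
        ((c - b) • x - w.conj * x - p * v.conj - p * u)
        (-(x.conj * w.conj) + (a - c) • x.conj - u.conj * p - v * p)
        (v.conj * x.conj - x * u.conj + (b - a) • p + (p * w + w * p)) := by
  simp only [Gm1, Gm2, add_apply, sub_apply, Atilde_zero_h1, Atilde_one_h1, Atilde_two_h1,
    delta_h1, h1_sub, h1_add]
  apply h1_congr <;> try simp only [Oct.ip_neg_left, Oct.ip_conj, Oct.conj_mul, Oct.conj_neg,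
    Oct.conj_of_re_eq_zero hp, Oct.conj_conj, Oct.neg_mul, Oct.mul_neg]
  any_goals ring1
  all_goals module

/-! ### Exponentials on the distinguished vectors -/

/-- With `Gp_Qp` and `Gp_F3` this shows that N⁺ acts unipotently on the span of P⁻, the Q⁺(y) and
the F₃(q) with q imaginary. The P⁻-coefficients 2(x|y) and -2(p|q) recover x and p, which is why
these vectors enter `nI`. -/
theorem Gp_Pm {x p : Oct ℝ} (hp : p.re = 0) : (Gp1 x + Gp2 p) Pm = 0 := by
  rw [Pm, Gp_h1 hp, ← h1_zero]
  have h : p.ip 1 = 0 := by rw [Oct.ip_comm, Oct.one_ip, hp]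
  apply h1_congr <;> simp [Oct.one_mul, Oct.mul_one, Oct.mul_zero, Oct.zero_mul, h]
  module

theorem Gp_Qp {x p : Oct ℝ} (hp : p.re = 0) (y : Oct ℝ) :
    (Gp1 x + Gp2 p) (Qp y) = (2 * x.ip y) • Pm := by
  rw [Qp, Pm, Gp_h1 hp, h1_smul, ← Oct.mul_conj_add]
  apply h1_congr <;> simp [Oct.conj_conj, Oct.mul_zero, Oct.zero_mul]
  module

theorem Oct.ip_mul_self_of_re_eq_zero {q : Oct ℝ} (hq : q.re = 0) (x : Oct ℝ) :
    x.ip (q * x) = 0 := by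
  have h := Oct.ip_mul x q x
  rw [Oct.conj_of_re_eq_zero hq, Oct.neg_mul, Oct.ip_neg] at h
  linarith

theorem Oct.mul_add_mul_of_re_eq_zero {p q : Oct ℝ} (hp : p.re = 0) (hq : q.re = 0) :
    p * q + q * p = (-(2 * p.ip q)) • 1 := by
  have h := Oct.mul_conj_add p q
  rw [Oct.conj_of_re_eq_zero hp, Oct.conj_of_re_eq_zero hq, Oct.mul_neg, Oct.mul_neg] at h
  linear_combination (norm := module) -h

theorem Gp_F3 {x p q : Oct ℝ} (hp : p.re = 0) (hq : q.re = 0) :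
    (Gp1 x + Gp2 p) (F3 q) = Qp (-(q * x)) + (-(2 * p.ip q)) • Pm := by
  rw [F3, Qp, Pm, Gp_h1 hp, h1_smul, h1_add, ← Oct.mul_add_mul_of_re_eq_zero hp hq]
  apply h1_congr <;> simp [Oct.conj_of_re_eq_zero hq, Oct.conj_neg, Oct.conj_mul, Oct.mul_zero,
    Oct.zero_mul, Oct.neg_mul, Oct.mul_neg]

theorem exp_Gp_Pm {x p : Oct ℝ} (hp : p.re = 0) : NormedSpace.exp (Gp1 x + Gp2 p) Pm = Pm :=
  exp_apply_of_apply_eq_zero (Gp_Pm hp)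

theorem exp_Gp_Qp {x p : Oct ℝ} (hp : p.re = 0) (y : Oct ℝ) :
    NormedSpace.exp (Gp1 x + Gp2 p) (Qp y) = Qp y + (2 * x.ip y) • Pm := by
  rw [exp_apply_of_pow_apply_eq_zero (n := 2)
    (by rw [pow_two, mul_apply_eq_comp, Gp_Qp hp, map_smul, Gp_Pm hp, smul_zero])]
  simp only [Finset.sum_range_succ, Finset.sum_range_zero, pow_zero, pow_one, Gp_Qp hp]
  simp

theorem exp_Gp_F3 {x p q : Oct ℝ} (hp : p.re = 0) (hq : q.re = 0) :
    NormedSpace.exp (Gp1 x + Gp2 p) (F3 q) =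
      F3 q + Qp (-(q * x)) + (-(2 * p.ip q)) • Pm := by
  -- The only surviving term is a multiple of (x|qx), which vanishes since q is imaginary.
  have h2 : ((Gp1 x + Gp2 p) ^ 2) (F3 q) = 0 := by
    rw [pow_two, mul_apply_eq_comp, Gp_F3 hp hq, map_add, map_smul, Gp_Pm hp, Gp_Qp hp,
      Oct.ip_neg, Oct.ip_mul_self_of_re_eq_zero hq]
    simp
  rw [exp_apply_of_pow_apply_eq_zero h2]
  simp only [Finset.sum_range_succ, Finset.sum_range_zero, pow_zero, pow_one, Gp_F3 hp hq]
  simp [add_assoc]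

theorem Gm_Pm {x p : Oct ℝ} (hp : p.re = 0) :
    (Gm1 x + Gm2 p) Pm = h1 0 0 0 ((-2 : ℝ) • x) ((-2 : ℝ) • x.conj) ((4 : ℝ) • p) := by
  rw [Pm, Gm_h1 hp]
  have h : p.ip 1 = 0 := by rw [Oct.ip_comm, Oct.one_ip, hp]
  apply h1_congr <;> simp [Oct.one_mul, Oct.mul_one, Oct.mul_zero, Oct.zero_mul, h]
  all_goals module

theorem Gm_pow_two_Pm {x p : Oct ℝ} (hp : p.re = 0) :
    ((Gm1 x + Gm2 p) ^ 2) Pm = h1 (-8 * p.ip p - 4 * x.ip x) (8 * p.ip p - 4 * x.ip x)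
      (8 * x.ip x) ((8 : ℝ) • (p * x)) ((-8 : ℝ) • (p * x).conj) ((-8 * p.ip p) • 1) := by
  have h := Oct.mul_add_mul_of_re_eq_zero hp hp
  rw [pow_two, mul_apply_eq_comp, Gm_Pm hp, Gm_h1 hp]
  apply h1_congr <;> simp [Oct.conj_smul, Oct.conj_neg, Oct.ip_neg, Oct.conj_conj, Oct.ip_smul,
    Oct.mul_smul, Oct.smul_mul,
    Oct.conj_mul, Oct.conj_of_re_eq_zero hp, Oct.neg_mul, Oct.mul_neg]
  · ring
  · ring
  · ring
  · module
  · module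
  · linear_combination (norm := module) (4 : ℝ) • h

theorem Gm_pow_three_Pm {x p : Oct ℝ} (hp : p.re = 0) :
    ((Gm1 x + Gm2 p) ^ 3) Pm =
      h1 0 0 0 ((12 * x.ip x) • x) ((-12 * x.ip x) • x.conj) 0 := by
  have h3 := Oct.ip_mul_self_of_re_eq_zero hp x
  have h4 : p.ip 1 = 0 := by rw [Oct.ip_comm, Oct.one_ip, hp]
  have h5 := Oct.mul_conj_mul_self x p
  have h6 := congrArg Oct.conj h5
  rw [pow_succ', mul_apply_eq_comp, Gm_pow_two_Pm hp, Gm_h1 hp]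
  simp only [Oct.conj_mul, Oct.conj_conj, Oct.conj_smul, Oct.conj_of_re_eq_zero hp, Oct.neg_mul] at h6
  apply h1_congr <;> simp [Oct.conj_smul, Oct.conj_neg, Oct.ip_neg, Oct.conj_conj, Oct.ip_smul,
    Oct.mul_smul, Oct.smul_mul,
    Oct.conj_mul, Oct.conj_of_re_eq_zero hp, Oct.neg_mul, Oct.mul_neg, h3, h4, Oct.one_mul,
    Oct.mul_one]
  · module
  · module
  · linear_combination (norm := module) (8 : ℝ) • h5 - (-8 : ℝ) • h6

theorem Gm_pow_four_Pm {x p : Oct ℝ} (hp : p.re = 0) :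
    ((Gm1 x + Gm2 p) ^ 4) Pm = (24 * x.ip x ^ 2) • act sigma Pm := by
  have h := Oct.mul_conj_add x x
  rw [pow_succ', mul_apply_eq_comp, Gm_pow_three_Pm hp, Gm_h1 hp, sigma_Pm, h1_smul]
  apply h1_congr <;> simp [Oct.conj_smul, Oct.conj_neg, Oct.ip_neg, Oct.conj_conj, Oct.ip_smul,
    Oct.mul_smul, Oct.smul_mul,
    Oct.mul_zero, Oct.zero_mul, Oct.neg_mul, Oct.mul_neg]
  · ring
  · ring
  · linear_combination (norm := module) (-12 * x.ip x) • h

theorem Gm_sigma_Pm {x p : Oct ℝ} (hp : p.re = 0) : (Gm1 x + Gm2 p) (act sigma Pm) = 0 := by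
  rw [sigma_Pm, Gm_h1 hp, ← h1_zero]
  have h : p.ip 1 = 0 := by rw [Oct.ip_comm, Oct.one_ip, hp]
  apply h1_congr <;> simp [Oct.one_mul, Oct.mul_one, Oct.mul_zero, Oct.zero_mul, h, Oct.conj_neg,
    Oct.neg_mul, Oct.mul_neg, Oct.ip_neg]
  module

theorem exp_Gm_sigma_Pm {x p : Oct ℝ} (hp : p.re = 0) :
    NormedSpace.exp (Gm1 x + Gm2 p) (act sigma Pm) = act sigma Pm :=
  exp_apply_of_apply_eq_zero (Gm_sigma_Pm hp)

theorem exp_Gm_Pm {x p : Oct ℝ} (hp : p.re = 0) :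
    NormedSpace.exp (Gm1 x + Gm2 p) Pm =
      h1 (-1 - 4 * p.ip p - 2 * x.ip x - x.ip x ^ 2) (1 + 4 * p.ip p - 2 * x.ip x + x.ip x ^ 2)
        (4 * x.ip x) ((-2 + 2 * x.ip x) • x + (4 : ℝ) • (p * x))
        ((-2 - 2 * x.ip x) • x.conj - (4 : ℝ) • (p * x).conj)
        ((1 - 4 * p.ip p - x.ip x ^ 2) • 1 + (4 : ℝ) • p) := by
  -- The derivation lowers weights, P⁻ has weight 2, and the fourth power already lands in the line
  -- of σP⁻, which is annihilated; so the series stops after degree 4.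
  rw [exp_apply_of_pow_apply_eq_zero (n := 5)
    (by rw [pow_succ', mul_apply_eq_comp, Gm_pow_four_Pm hp, map_smul, Gm_sigma_Pm hp, smul_zero])]
  simp only [Finset.sum_range_succ, Finset.sum_range_zero, pow_zero, pow_one, Gm_Pm hp,
    Gm_pow_two_Pm hp, Gm_pow_three_Pm hp, Gm_pow_four_Pm hp, sigma_Pm, one_apply_eq_self, zero_add]
  simp only [Pm, h1_smul, h1_add]
  apply h1_congr <;> norm_num [Nat.factorial]
  any_goals ring1
  all_goals module

/-- The vectors P⁻, Q⁺(y) and F₃(q) with q imaginary are eigenvectors of weight 2, 1 and 0, so A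
acts on them by scalars. -/
theorem Atilde_two_one_Pm : Atilde 2 1 Pm = (2 : ℝ) • Pm := by
  rw [Pm, Atilde_two_h1, h1_smul, Oct.one_ip]
  apply h1_congr <;> simp [Oct.mul_zero, Oct.zero_mul, Oct.re]
  all_goals module

theorem Atilde_two_one_Qp (y : Oct ℝ) : Atilde 2 1 (Qp y) = Qp y := by
  rw [Qp, Atilde_two_h1, Oct.one_ip]
  apply h1_congr <;> simp [Oct.mul_one, Oct.one_mul, Oct.re, Oct.conj_conj]

theorem Atilde_two_one_F3 {q : Oct ℝ} (hq : q.re = 0) : Atilde 2 1 (F3 q) = 0 := by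
  rw [F3, Atilde_two_h1, Oct.one_ip, hq, ← h1_zero]
  apply h1_congr <;> simp [Oct.mul_zero, Oct.zero_mul]

theorem exp_Atilde_Pm (t : ℝ) :
    NormedSpace.exp (t • Atilde 2 1) Pm = Real.exp (2 * t) • Pm := by
  refine exp_apply_of_apply_eq_smul ?_
  rw [smul_apply, Atilde_two_one_Pm, smul_smul, mul_comm]

theorem exp_Atilde_Qp (t : ℝ) (y : Oct ℝ) :
    NormedSpace.exp (t • Atilde 2 1) (Qp y) = Real.exp t • Qp y := by
  refine exp_apply_of_apply_eq_smul ?_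
  rw [smul_apply, Atilde_two_one_Qp]

theorem exp_Atilde_F3 (t : ℝ) {q : Oct ℝ} (hq : q.re = 0) :
    NormedSpace.exp (t • Atilde 2 1) (F3 q) = F3 q := by
  refine exp_apply_of_apply_eq_zero ?_
  rw [smul_apply, Atilde_two_one_F3 hq, smul_zero]

/-! ### Rank-one elements and the orbit of `E₁` -/

theorem Oct.norm_mul (x y : Oct ℝ) : (x * y).ip (x * y) = x.ip x * y.ip y := by
  have h := Oct.mul_conj_mul_self x.conj y
  rw [Oct.conj_conj, Oct.ip_conj, Oct.conj_conj] at h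
  rw [Oct.ip_mul, h, Oct.ip_smul]

theorem Oct.ip_conj_conj (x y : Oct ℝ) : x.conj.ip y.conj = x.ip y := by
  rw [Oct.ip_conj, Oct.conj_conj]

theorem Oct.re_sq_le (x : Oct ℝ) : x.re ^ 2 ≤ x.ip x := by
  rw [Oct.ip_eq, Oct.re]
  simp only [← sq]
  have h : 0 ≤ x.1.imI ^ 2 + x.1.imJ ^ 2 + x.1.imK ^ 2 + x.2.re ^ 2 + x.2.imI ^ 2
    + x.2.imJ ^ 2 + x.2.imK ^ 2 := by positivity
  linarith

theorem Oct.exists_ne_zero_ip_eq_zero (z : Oct ℝ) : ∃ u : Oct ℝ, u ≠ 0 ∧ z.ip u = 0 := by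
  by_cases hz : z = 0
  · refine ⟨1, fun h => ?_, by simp [hz]⟩
    have := congrArg Oct.re h
    simp [Oct.re] at this
  · have he : (Oct.e 1).re = 0 := by simp [Oct.e, Oct.re]
    refine ⟨Oct.e 1 * z, fun h => hz ?_, Oct.ip_mul_self_of_re_eq_zero he z⟩
    have h' := Oct.norm_mul (Oct.e 1) z
    rw [h, Oct.ip_zero] at h'
    have h1 : (Oct.e 1).ip (Oct.e 1) = 1 := by rw [Oct.ip_eq]; simp [Oct.e]
    rw [h1, one_mul] at h'
    exact Oct.ip_self_eq_zero.1 h'.symm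

theorem tr_eq (X : J1) : tr X = X.1 0 + X.1 1 + X.1 2 := Fin.sum_univ_three _

theorem jmul_E (X : J1) : jmul X E = X := by
  refine Prod.ext (funext fun i => ?_) (funext fun i => ?_) <;> fin_cases i <;>
    simp [jmul, E, h1, Oct.mul_zero, Oct.zero_mul] <;> module

theorem act_E (g : F4) : act g E = E := by
  have h := act_jmul g (act g⁻¹ E) E
  rwa [jmul_E, act_act_inv, jmul_comm, jmul_E, eq_comm] at h

theorem act_cross (g : F4) (X Y : J1) : act g (cross X Y) = cross (act g X) (act g Y) := by
  simp only [cross, map_smul, map_add, map_sub, act_jmul, tr_act, ip_act, act_E]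

theorem cross_self (X : J1) : cross X X =
    h1 (X.1 1 * X.1 2 - (X.2 0).ip (X.2 0)) (X.1 2 * X.1 0 + (X.2 1).ip (X.2 1))
      (X.1 0 * X.1 1 + (X.2 2).ip (X.2 2)) (-(X.1 0 • X.2 0) - (X.2 1 * X.2 2).conj)
      (-(X.1 1 • X.2 1) + (X.2 2 * X.2 0).conj) (-(X.1 2 • X.2 2) + (X.2 0 * X.2 1).conj) := by
  rw [cross, tr_eq, ip_eq]
  refine Prod.ext (funext fun i => ?_) (funext fun i => ?_) <;> fin_cases i <;>
    simp [jmul, E, h1, sgn, Oct.conj_add]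
  any_goals ring1
  all_goals module

theorem h1_eq_zero {a b c : ℝ} {x y z : Oct ℝ} (h : h1 a b c x y z = 0) :
    a = 0 ∧ b = 0 ∧ c = 0 ∧ x = 0 ∧ y = 0 ∧ z = 0 :=
  ⟨congrFun (congrArg Prod.fst h) 0, congrFun (congrArg Prod.fst h) 1,
    congrFun (congrArg Prod.fst h) 2, congrFun (congrArg Prod.snd h) 0,
    congrFun (congrArg Prod.snd h) 1, congrFun (congrArg Prod.snd h) 2⟩

theorem cross_self_E1 : cross E1 E1 = 0 := by
  rw [cross_self, ← h1_zero]
  apply h1_congr <;> simp [E1, h1, Oct.mul_zero]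

theorem jmul_E1 (F : J1) : jmul E1 F =
    h1 (F.1 0) 0 0 0 ((1 / 2 : ℝ) • F.2 1) ((1 / 2 : ℝ) • F.2 2) := by
  refine Prod.ext (funext fun i => ?_) (funext fun i => ?_) <;> fin_cases i <;>
    simp [jmul, E1, h1, Oct.mul_zero, Oct.zero_mul]

theorem ip_E1 (X : J1) : ip X E1 = X.1 0 := by
  simp [ip_eq, E1, h1]

/-- By invariance it suffices to take g = 1. The operator L(E₁) has eigenvalues 1, 1/2 and 0, and
the inner product is negative definite on the 1/2-eigenspace. There L ≤ L² as forms, while the other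
eigenspaces give equality. -/
theorem ip_jmul_act_E1_le (g : F4) (F : J1) :
    ip F (jmul (act g E1) F) ≤ ip (jmul (act g E1) F) (jmul (act g E1) F) := by
  have h : jmul (act g E1) F = act g (jmul E1 (act g⁻¹ F)) := by rw [act_jmul, act_act_inv]
  have hF : ip F (act g (jmul E1 (act g⁻¹ F))) = ip (act g⁻¹ F) (jmul E1 (act g⁻¹ F)) := by
    rw [ip_act_left, inv_inv]
  rw [h, ip_act, hF, jmul_E1, ip_eq, ip_h1]
  simp [h1, Oct.ip_smul, Oct.ip_smul_left]
  nlinarith [Oct.ip_self_nonneg ((act g⁻¹ F).2 1), Oct.ip_self_nonneg ((act g⁻¹ F).2 2)]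

/-- The equations satisfied by the elements of the orbit of `E₁`. -/
theorem act_E1_mem (g : F4) : cross (act g E1) (act g E1) = 0 ∧ tr (act g E1) = 1 := by
  rw [← act_cross, cross_self_E1, map_zero, tr_act]
  simp [tr_eq, E1, h1]

theorem one_le_act_E1 (g : F4) : 1 ≤ (act g E1).1 0 := by
  obtain ⟨hc, ht⟩ := act_E1_mem g
  have hle := ip_jmul_act_E1_le g
  set Z := act g E1
  rw [cross_self] at hc
  rw [tr_eq] at ht
  obtain ⟨-, h2, h3, -⟩ := h1_eq_zero hc
  -- Testing the inequality on F₁(u) with u orthogonal to the first octonion entry of Z removes the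
  -- diagonal part of the product. The norms of the other two entries are then eliminated by Z × Z =
  -- 0, which leaves (1 - ξ₁)|u|² ≤ 0.
  obtain ⟨u, hu, hzu⟩ := Oct.exists_ne_zero_ip_eq_zero (Z.2 0)
  have hU : 0 < u.ip u := (Oct.ip_self_nonneg u).lt_of_ne' fun h => hu (Oct.ip_self_eq_zero.1 h)
  have hj : jmul Z (h1 0 0 0 u 0 0) = h1 0 0 0 ((1 / 2 * (Z.1 1 + Z.1 2)) • u)
      ((1 / 2 : ℝ) • (Z.2 2 * u).conj) ((1 / 2 : ℝ) • (u * Z.2 1).conj) := by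
    refine Prod.ext (funext fun i => ?_) (funext fun i => ?_) <;> fin_cases i <;>
      simp [jmul, h1, sgn, Oct.mul_zero, Oct.zero_mul, hzu, smul_smul]
  have h := hle (h1 0 0 0 u 0 0)
  rw [hj, ip_h1, ip_h1] at h
  simp only [Oct.ip_smul, Oct.ip_smul_left, Oct.ip_conj_conj, Oct.norm_mul, Oct.zero_ip] at h
  have h2' : (Z.2 1).ip (Z.2 1) = -(Z.1 2 * Z.1 0) := by linarith
  have h3' : (Z.2 2).ip (Z.2 2) = -(Z.1 0 * Z.1 1) := by linarith
  rw [h2', h3'] at h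
  have hm : Z.1 1 + Z.1 2 = 1 - Z.1 0 := by linarith
  have hkey : (1 - Z.1 0) * u.ip u ≤ 0 := by
    have e : Z.1 2 = 1 - Z.1 0 - Z.1 1 := by linarith
    rw [e] at h
    nlinarith [h]
  by_contra hlt
  nlinarith [mul_pos (sub_pos.2 (not_le.1 hlt)) hU]

theorem act_E1_nonpos (g : F4) : (act g E1).1 1 ≤ 0 ∧ (act g E1).1 2 ≤ 0 := by
  have hc := (act_E1_mem g).1
  have h1 := one_le_act_E1 g
  rw [cross_self] at hc
  obtain ⟨-, h2, h3, -⟩ := h1_eq_zero hc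
  have n1 := Oct.ip_self_nonneg ((act g E1).2 1)
  have n2 := Oct.ip_self_nonneg ((act g E1).2 2)
  constructor <;> nlinarith

theorem ip_Pm (X : J1) : ip X Pm = -X.1 0 + X.1 1 - 2 * (X.2 2).re := by
  rw [ip_eq, ← Oct.one_ip, Oct.ip_comm 1]
  simp [Pm, h1]

theorem ip_sigma_Pm (X : J1) : ip X (act sigma Pm) = -X.1 0 + X.1 1 + 2 * (X.2 2).re := by
  rw [sigma_Pm, ip_eq, ← Oct.one_ip, Oct.ip_comm 1]
  simp [h1, Oct.ip_neg]

theorem ip_act_Pm_E1_neg (g : F4) : ip (act g Pm) E1 < 0 := by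
  rw [ip_act_left, ip_comm, ip_Pm]
  obtain ⟨hc, ht⟩ := act_E1_mem g⁻¹
  have h1 := one_le_act_E1 g⁻¹
  obtain ⟨n1, n2⟩ := act_E1_nonpos g⁻¹
  have hr := Oct.re_sq_le ((act g⁻¹ E1).2 2)
  rw [cross_self] at hc
  rw [tr_eq] at ht
  obtain ⟨-, -, h3, -⟩ := h1_eq_zero hc
  -- With Z = g⁻¹E₁, a nonnegative pairing would give ξ₁ - ξ₂ ≤ -2 Re x₃, hence (ξ₁ - ξ₂)² ≤ 4|x₃|²
  -- = -4ξ₁ξ₂ and so ξ₁ + ξ₂ = 0. But ξ₁ + ξ₂ = 1 - ξ₃ ≥ 1.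
  by_contra hlt
  nlinarith

theorem Pm_mem : Pm ∈ NullCone := by
  refine ⟨?_, ?_, ?_⟩
  · rw [cross_self, ← h1_zero]
    apply h1_congr <;> simp [Pm, h1, Oct.mul_zero, Oct.zero_mul, Oct.one_ip, Oct.re]
  · simp [tr_eq, Pm, h1]
  · rw [ip_comm, ip_E1]; simp [Pm, h1]

theorem act_Pm_mem (g : F4) : act g Pm ∈ NullCone := by
  refine ⟨?_, ?_, ?_⟩
  · rw [← act_cross, Pm_mem.1, map_zero]
  · rw [tr_act, Pm_mem.2.1]
  · rw [ip_comm]; exact ip_act_Pm_E1_neg g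

/-! ### The subgroups `K` and `M` as stabilizers -/

theorem sigma_mul_self : sigma * sigma = 1 :=
  act_injective sigmaLin_mul_self

theorem sigma_inv : sigma⁻¹ = sigma := inv_eq_of_mul_eq_one_left sigma_mul_self

theorem act_sigma_sigma (X : J1) : act sigma (act sigma X) = X := by
  rw [← act_mul_apply, sigma_mul_self, act_one]

/-- As a polynomial in L(E₁), σ commutes with every automorphism fixing E₁: the value 1 - 8(λ - λ²)
is -1 at λ = 1/2 and 1 at λ = 0, 1. -/
theorem act_sigma_eq (X : J1) :
    act sigma X = X - (8 : ℝ) • (jmul E1 X - jmul E1 (jmul E1 X)) := by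
  rw [jmul_E1, jmul_E1]
  nth_rw 1 2 [eq_h1 X]
  rw [sigma_h1, h1_sub, h1_smul, h1_sub]
  apply h1_congr <;> simp [h1]
  all_goals module

/-- If k commutes with σ, then kE₁ is σ-fixed, so its last two octonion entries vanish. The
equations of the orbit and the nonvanishing of its first entry then leave only E₁. -/
theorem mem_K_iff {k : F4} : k ∈ K ↔ act k E1 = E1 := by
  constructor
  · intro hk
    have hcomm : sigma * k = k * sigma := mul_inv_eq_iff_eq_mul.1 hk
    have hfix : act sigma (act k E1) = act k E1 := by
      rw [← act_mul_apply, hcomm, act_mul_apply]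
      congr 1
      rw [E1, sigma_h1, neg_zero]
    obtain ⟨hc, ht⟩ := act_E1_mem k
    have h1le := one_le_act_E1 k
    set Z := act k E1
    have hy : Z.2 1 = 0 := by
      have h : -Z.2 1 = Z.2 1 := congrFun (congrArg Prod.snd hfix) 1
      linear_combination (norm := module) (-1 / 2 : ℝ) • h
    have hz : Z.2 2 = 0 := by
      have h : -Z.2 2 = Z.2 2 := congrFun (congrArg Prod.snd hfix) 2
      linear_combination (norm := module) (-1 / 2 : ℝ) • h
    rw [cross_self, hy, hz] at hc
    obtain ⟨h0, h1', h2', -⟩ := h1_eq_zero hc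
    rw [tr_eq] at ht
    simp only [Oct.ip_zero, add_zero, mul_eq_zero] at h1' h2'
    have hne : Z.1 0 ≠ 0 := by linarith
    have a1 : Z.1 1 = 0 := h2'.resolve_left hne
    have a2 : Z.1 2 = 0 := h1'.resolve_right hne
    have hx : Z.2 0 = 0 := by
      rw [a1, zero_mul, zero_sub, neg_eq_zero] at h0
      exact Oct.ip_self_eq_zero.1 h0
    rw [eq_h1 Z, E1]
    exact h1_congr (by linarith) a1 a2 hx hy hz
  · intro hk
    refine act_injective (ContinuousLinearMap.ext fun X => ?_)
    rw [sigma_inv, act_mul_apply, act_mul_apply, act_sigma_eq (act k _), ← hk, ← act_jmul,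
      ← act_jmul, ← map_sub, ← map_smul, ← map_sub, ← act_sigma_eq, act_sigma_sigma]

theorem mem_K_iff_inv {k : F4} : k ∈ K ↔ act k⁻¹ E1 = E1 := by
  rw [mem_K_iff]
  exact ⟨fun h => by rw [← h, act_inv_act, h], fun h => by rw [← h, act_act_inv, h]⟩

/-- The commutator formula shows that an automorphism commutes with Ã₃(1) once it fixes E₁ and
F₃(1). -/
theorem Atilde_two_one_eq (X : J1) :
    Atilde 2 1 X = (4 : ℝ) • (jmul E1 (jmul (F3 1) X) - jmul (F3 1) (jmul E1 X)) := by
  have hF (X : J1) : jmul (F3 1) X = h1 (-(X.2 2).re) (-(X.2 2).re) 0 ((-1 / 2 : ℝ) • (X.2 1).conj)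
      ((1 / 2 : ℝ) • (X.2 0).conj) (((X.1 0 + X.1 1) / 2) • 1) := by
    refine Prod.ext (funext fun i => ?_) (funext fun i => ?_) <;> fin_cases i <;>
      simp [jmul, F3, h1, sgn, Oct.mul_zero, Oct.zero_mul, Oct.one_ip, Oct.one_mul, Oct.mul_one]
    all_goals module
  nth_rw 1 [eq_h1 X]
  rw [hF, hF, jmul_E1, jmul_E1, h1_sub, h1_smul, Atilde_two_h1, Oct.one_ip, Oct.one_mul, Oct.mul_one]
  apply h1_congr <;> simp [h1, Oct.conj_smul, Oct.re]
  any_goals ring1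
  all_goals module

/-- Applying Ã₃(1) to E₁ yields F₃(1), and applying it again yields E₂; so a k in M fixes all three,
hence P⁻. Conversely F₃(1) is recovered from E₁ and P⁻ by the Jordan product. -/
theorem mem_M_iff {k : F4} : k ∈ M ↔ act k E1 = E1 ∧ act k Pm = Pm := by
  have hE2 : Pm = -E1 + h1 0 1 0 0 0 0 + F3 1 := by
    rw [Pm, E1, F3, ← neg_one_smul ℝ (h1 _ _ _ _ _ _), h1_smul, h1_add, h1_add]
    apply h1_congr <;> simp
  constructor
  · rintro ⟨hK, hM⟩
    have hE := mem_K_iff.1 hK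
    have hcomm (X : J1) : act k (Atilde 2 1 X) = Atilde 2 1 (act k X) := by
      nth_rw 2 [← hM]
      rw [mul_apply_eq_comp, mul_apply_eq_comp, act_inv_act]
    have hF : act k (F3 1) = F3 1 := by
      have h : F3 1 = -Atilde 2 1 E1 := by
        rw [E1, Atilde_two_h1, F3, ← neg_one_smul ℝ (h1 _ _ _ _ _ _), h1_smul]
        apply h1_congr <;> simp [Oct.mul_zero, Oct.zero_mul]
      rw [h, map_neg, hcomm, hE]
    have h2 : act k (h1 0 1 0 0 0 0) = h1 0 1 0 0 0 0 := by
      have h : h1 0 1 0 0 0 0 = E1 + (1 / 2 : ℝ) • Atilde 2 1 (F3 1) := by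
        rw [E1, F3, Atilde_two_h1, h1_smul, h1_add, Oct.one_ip]
        apply h1_congr <;> simp [Oct.mul_zero, Oct.zero_mul, Oct.re]
      rw [h, map_add, map_smul, hcomm, hE, hF]
    refine ⟨hE, ?_⟩
    rw [hE2, map_add, map_add, map_neg, hE, h2, hF]
  · rintro ⟨hE, hP⟩
    refine ⟨mem_K_iff.2 hE, ?_⟩
    have hF : act k (F3 1) = F3 1 := by
      have h : F3 1 = (2 : ℝ) • (jmul E1 Pm + E1) := by
        rw [jmul_E1, E1, F3, h1_add, h1_smul]
        apply h1_congr <;> simp [Pm, h1]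
      rw [h, map_smul, map_add, act_jmul, hE, hP]
    refine ContinuousLinearMap.ext fun X => ?_
    rw [mul_apply_eq_comp, mul_apply_eq_comp, Atilde_two_one_eq, map_smul, map_sub, act_jmul,
      act_jmul, act_jmul, act_jmul, hE, hF, act_act_inv, ← Atilde_two_one_eq]

/-! ### The Iwasawa decomposition -/

theorem Oct.sum_ip_smul_e (x : Oct ℝ) : ∑ i : Fin 8, x.ip (Oct.e i) • Oct.e i = x := by
  simp only [Oct.ip_eq, Fin.sum_univ_eight]
  apply Oct.ext_coord <;>
    simp only [Oct.fst_add, Oct.snd_add, Oct.fst_smul, Oct.snd_smul, Quaternion.re_add,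
      Quaternion.imI_add, Quaternion.imJ_add, Quaternion.imK_add, Quaternion.re_smul,
      Quaternion.imI_smul, Quaternion.imJ_smul, Quaternion.imK_smul] <;>
    simp [Oct.e]

theorem Oct.sum_ip_smul_e_succ (x : Oct ℝ) :
    ∑ i : Fin 7, x.ip (Oct.e i.succ) • Oct.e i.succ = x - x.re • 1 := by
  have h := Oct.sum_ip_smul_e x
  have h0 : Oct.e 0 = 1 := by apply Oct.ext_coord <;> simp [Oct.e]
  rw [Fin.sum_univ_succ, h0, Oct.ip_comm, Oct.one_ip] at h
  exact eq_sub_of_add_eq' h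

theorem Oct.re_e_succ (i : Fin 7) : (Oct.e i.succ).re = 0 := by
  simp [Oct.e, Oct.re, Fin.succ_ne_zero]

theorem Oct.re_sub_re (x : Oct ℝ) : (x - x.re • 1).re = 0 := by
  simp [Oct.re]

theorem Oct.re_smul (r : ℝ) (x : Oct ℝ) : (r • x).re = r * x.re := rfl

theorem Oct.re_neg (x : Oct ℝ) : (-x).re = -x.re := rfl

theorem Oct.ip_sub_re {x y : Oct ℝ} (hy : y.re = 0) : (x - x.re • 1).ip y = x.ip y := by
  rw [Oct.ip_sub_left, Oct.ip_smul_left, Oct.one_ip, hy, mul_zero, sub_zero]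

theorem ip_Qp (X : J1) (y : Oct ℝ) : ip (Qp y) X = 2 * (X.2 0 - (X.2 1).conj).ip y := by
  rw [ip_eq, Oct.ip_sub_left, Oct.ip_comm (X.2 0), Oct.ip_conj, Oct.ip_comm (X.2 1)]
  simp [Qp, h1]; ring

theorem ip_Qm (X : J1) (y : Oct ℝ) : ip (Qm y) X = 2 * (X.2 0 + (X.2 1).conj).ip y := by
  rw [ip_eq, Oct.ip_add_left, Oct.ip_comm (X.2 0), Oct.ip_conj, Oct.ip_comm (X.2 1)]
  simp [Qm, h1, Oct.ip_neg_left]; ring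

theorem ip_F3 (X : J1) (y : Oct ℝ) : ip (F3 y) X = -2 * (X.2 2).ip y := by
  rw [ip_eq, Oct.ip_comm (X.2 2)]
  simp [F3, h1]

theorem neg_Gp (x p : Oct ℝ) : -(Gp1 x + Gp2 p) = Gp1 (-x) + Gp2 (-p) := by
  refine ContinuousLinearMap.ext fun X => ?_
  rw [eq_h1 X]
  simp only [Gp1, Gp2, neg_apply, add_apply, sub_apply, Atilde_zero_h1, Atilde_one_h1, Atilde_two_h1,
    delta_h1, ← neg_one_smul ℝ (h1 _ _ _ _ _ _), h1_sub, h1_smul, h1_add, Oct.conj_neg,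
    Oct.neg_mul, Oct.mul_neg, Oct.ip_neg_left]
  apply h1_congr
  any_goals ring1
  all_goals module

theorem nI_eq (g : F4) : nI g = NormedSpace.exp
    (Gp1 ((ip (act g Pm) E1)⁻¹ • ((act g⁻¹ E1).2 0 - ((act g⁻¹ E1).2 1).conj))
      + Gp2 ((ip (act g Pm) E1)⁻¹ • ((act g⁻¹ E1).2 2 - ((act g⁻¹ E1).2 2).re • 1))) := by
  rw [nI]
  simp only [ip_act_left g (Qp _), ip_act_left g (F3 _), ip_Qp, ip_F3, ← smul_smul _ (Oct.ip _ _)]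
  rw [← Finset.smul_sum, ← Finset.smul_sum, Oct.sum_ip_smul_e, Oct.sum_ip_smul_e_succ, smul_smul,
    smul_smul]
  congr 4 <;> ring

/-- Since k fixes E₁, pairing with E₁ just reads the first diagonal entry of an X. Only P⁻ has a
nonzero one, so the pairings return its coefficients, each multiplied by -exp(2t). This gives
uniqueness of a and n. -/
theorem nI_of_eq_mul {k a n : F4} {t : ℝ} {x p : Oct ℝ} (hk : act k E1 = E1)
    (ha : act a = NormedSpace.exp (t • Atilde 2 1)) (hp : p.re = 0)
    (hn : act n = NormedSpace.exp (Gp1 x + Gp2 p)) :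
    ip (act (k * a * n) Pm) E1 = -Real.exp (2 * t) ∧ nI (k * a * n) = act n := by
  have hE (X : J1) : ip (act k X) E1 = X.1 0 := by
    nth_rw 1 [← hk]
    rw [ip_act, ip_E1]
  have hP : ip (act (k * a * n) Pm) E1 = -Real.exp (2 * t) := by
    rw [act_mul_apply, act_mul_apply, hE, ha, hn, exp_Gp_Pm hp, exp_Atilde_Pm]
    simp [Pm, h1]
  have hQ (y : Oct ℝ) : ip (act (k * a * n) (Qp y)) E1 = (-2 * Real.exp (2 * t)) * x.ip y := by
    rw [act_mul_apply, act_mul_apply, hE, ha, hn, exp_Gp_Qp hp, map_add, map_smul, exp_Atilde_Pm,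
      exp_Atilde_Qp]
    simp [Pm, Qp, h1]; ring
  have hF {q : Oct ℝ} (hq : q.re = 0) :
      ip (act (k * a * n) (F3 q)) E1 = (2 * Real.exp (2 * t)) * p.ip q := by
    rw [act_mul_apply, act_mul_apply, hE, ha, hn, exp_Gp_F3 hp hq, map_add, map_add, map_smul,
      exp_Atilde_Pm, exp_Atilde_Qp, exp_Atilde_F3 _ hq]
    simp [Pm, Qp, F3, h1]; ring
  refine ⟨hP, ?_⟩
  rw [nI, hn, hP]
  simp only [hQ, hF (Oct.re_e_succ _), ← smul_smul _ (Oct.ip _ _)]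
  rw [← Finset.smul_sum, ← Finset.smul_sum, Oct.sum_ip_smul_e, Oct.sum_ip_smul_e_succ, hp,
    zero_smul, sub_zero, smul_smul, smul_smul]
  have h0 := (Real.exp_pos (2 * t)).ne'
  have e1 : 1 / 2 * (-Real.exp (2 * t))⁻¹ * (-2 * Real.exp (2 * t)) = 1 := by field_simp
  have e2 : -(1 / 2) * (-Real.exp (2 * t))⁻¹ * (2 * Real.exp (2 * t)) = 1 := by field_simp
  rw [e1, e2, one_smul, one_smul]

/-- An automorphism `k` fixes `E₁` as soon as `k E₁` has the same inner products as `E₁` with `P⁻`,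
the `Q⁺(y)` and the `F₃¹(q)`, `q` imaginary. -/
theorem act_E1_eq_of_ip {k : F4} (hP : ip Pm (act k E1) = -1)
    (hQ : ∀ y, ip (Qp y) (act k E1) = 0) (hF : ∀ q : Oct ℝ, q.re = 0 → ip (F3 q) (act k E1) = 0) :
    act k E1 = E1 := by
  obtain ⟨hc, ht⟩ := act_E1_mem k
  have h1le := one_le_act_E1 k
  obtain ⟨n1, n2⟩ := act_E1_nonpos k
  set Z := act k E1
  have hy : Z.2 0 = (Z.2 1).conj := by
    have h := hQ (Z.2 0 - (Z.2 1).conj)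
    rw [ip_Qp] at h
    exact sub_eq_zero.1 (Oct.ip_self_eq_zero.1 (by linarith))
  have hz : Z.2 2 = (Z.2 2).re • 1 := by
    have h := hF (Z.2 2 - (Z.2 2).re • 1) (Oct.re_sub_re _)
    rw [ip_F3, ← Oct.ip_sub_re (Oct.re_sub_re _)] at h
    exact sub_eq_zero.1 (Oct.ip_self_eq_zero.1 (by linarith))
  rw [ip_comm, ip_Pm] at hP
  rw [cross_self] at hc
  rw [tr_eq] at ht
  obtain ⟨e0, e1, e2, -⟩ := h1_eq_zero hc
  set c := (Z.2 2).re
  have hzz : (Z.2 2).ip (Z.2 2) = c ^ 2 := by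
    nth_rw 1 [hz]
    rw [Oct.ip_smul_left, Oct.one_ip, sq]
  rw [hy, Oct.ip_conj_conj] at e0
  rw [hzz] at e2
  have h2 : Z.1 2 = 0 := by
    -- The sum of the first two diagonal equations of Z × Z = 0, where the equal norms of the first
    -- two octonion entries cancel. The second factor cannot vanish: the trace would make the third
    -- entry 1, against its nonpositivity.
    have h : Z.1 2 * (Z.1 0 + Z.1 1) = 0 := by linarith
    rcases mul_eq_zero.1 h with h | h
    · exact h
    · linarith
  have h0 : Z.1 0 = 1 := by
    have hc' : c = 1 - Z.1 0 := by linarith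
    have h1' : Z.1 1 = 1 - Z.1 0 := by linarith
    rw [hc', h1'] at e2
    nlinarith
  have hx1 : Z.2 1 = 0 := Oct.ip_self_eq_zero.1 (by rw [h2] at e1; linarith)
  rw [eq_h1 Z, E1]
  refine h1_congr h0 (by linarith) h2 (by rw [hy, hx1, Oct.conj_zero]) hx1 ?_
  rw [hz, show c = 0 by linarith, zero_smul]

theorem iwasawa (g : F4) : ∃ k ∈ K, ∃ a ∈ A, ∃ n ∈ Np, g = k * a * n ∧ act n = nI g ∧
    ∀ k' ∈ K, ∀ a' ∈ A, ∀ n' ∈ Np, g = k' * a' * n' → k' = k ∧ a' = a ∧ n' = n := by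
  have hneg := ip_act_Pm_E1_neg g
  set c := ip (act g Pm) E1 with hc
  set Y := act g⁻¹ E1 with hY
  set x := c⁻¹ • (Y.2 0 - (Y.2 1).conj) with hx
  set p := c⁻¹ • (Y.2 2 - (Y.2 2).re • 1) with hpdef
  have hp : p.re = 0 := by rw [hpdef, Oct.re_smul, Oct.re_sub_re, mul_zero]
  -- Forced by (kanP⁻|E₁) = -exp(2t).
  set t := 1 / 2 * Real.log (-c) with ht
  have hexp : Real.exp (2 * t) = -c := by
    rw [ht, ← mul_assoc, mul_one_div_cancel two_ne_zero, one_mul, Real.exp_log (by linarith)]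
  let n : F4 := expDer (Gp1 x + Gp2 p) (.Gp x hp)
  let a : F4 := expDer (t • Atilde 2 1) (.Atilde_two_one t)
  have hn : act n = NormedSpace.exp (Gp1 x + Gp2 p) := rfl
  have ha : act a = NormedSpace.exp (t • Atilde 2 1) := rfl
  have hn' : act n⁻¹ = NormedSpace.exp (Gp1 (-x) + Gp2 (-p)) := by
    rw [act_inv_of_act_eq_exp hn, neg_Gp]
  have hp' : (-p).re = 0 := by rw [Oct.re_neg, hp, neg_zero]
  have ha' : act a⁻¹ = NormedSpace.exp ((-t) • Atilde 2 1) := by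
    rw [act_inv_of_act_eq_exp ha]
    exact congrArg _ (neg_smul t (Atilde 2 1)).symm
  have hnI : act n = nI g := by rw [nI_eq, hn]
  have hP : ip Pm Y = c := by rw [hc, ip_act_left]
  have hQ (y : Oct ℝ) : ip (Qp y) Y = 2 * c * x.ip y := by
    rw [ip_Qp, hx, Oct.ip_smul_left, mul_assoc, mul_inv_cancel_left₀ hneg.ne]
  have hF {q : Oct ℝ} (hq : q.re = 0) : ip (F3 q) Y = -2 * c * p.ip q := by
    rw [ip_F3, hpdef, Oct.ip_smul_left, mul_assoc, mul_inv_cancel_left₀ hneg.ne,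
      Oct.ip_sub_re hq]
  -- Pairings with k⁻¹E₁ are pairings of n⁻¹a⁻¹V with g⁻¹E₁. On P⁻, Q⁺(y) and F₃(q) the action of
  -- a⁻¹ and n⁻¹ is explicit, and x, p, t were chosen to normalize the results.
  have hZ (V : J1) : ip V (act (g * n⁻¹ * a⁻¹)⁻¹ E1) = ip (act n⁻¹ (act a⁻¹ V)) Y := by
    rw [← ip_act_left, act_mul_apply, act_mul_apply, ip_act_left]
  have hk : act (g * n⁻¹ * a⁻¹)⁻¹ E1 = E1 := by
    refine act_E1_eq_of_ip ?_ (fun y => ?_) (fun q hq => ?_)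
    · rw [hZ, ha', exp_Atilde_Pm, map_smul, hn', exp_Gp_Pm hp', ip_smul_left, hP, mul_neg,
        Real.exp_neg, hexp]
      have : c ≠ 0 := hneg.ne
      field_simp
    · rw [hZ, ha', exp_Atilde_Qp, map_smul, hn', exp_Gp_Qp hp', ip_smul_left, ip_add_left,
        ip_smul_left, hP, hQ, Oct.ip_neg_left]
      ring
    · rw [hZ, ha', exp_Atilde_F3 _ hq, hn', exp_Gp_F3 hp' hq, ip_add_left, ip_add_left,
        ip_smul_left, hP, hQ, hF hq, Oct.mul_neg, neg_neg, Oct.ip_mul_self_of_re_eq_zero hq,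
        Oct.ip_neg_left]
      ring
  refine ⟨g * n⁻¹ * a⁻¹, mem_K_iff_inv.2 hk, a, ⟨t, ha⟩, n, ⟨x, p, hp, hn⟩, by group, hnI, ?_⟩
  rintro k' hk' a' ⟨t', ha'⟩ n' ⟨x', p', hp', hn'⟩ hg
  obtain ⟨h1, h2⟩ := nI_of_eq_mul (mem_K_iff.1 hk') ha' hp' hn'
  rw [← hg] at h1 h2
  have hnn : n' = n := act_injective (by rw [← h2, hnI])
  have htt : t' = t := by
    have := Real.exp_injective (by rw [hexp, hc, h1, neg_neg] : Real.exp (2 * t') = Real.exp (2 * t))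
    linarith
  have haa : a' = a := act_injective (by rw [ha', ha, htt])
  refine ⟨?_, haa, hnn⟩
  rw [hg, hnn, haa]; group

/-! ### The null cone -/

theorem null_cone_equations {X : J1} (hX : X ∈ NullCone) :
    X.1 0 < 0 ∧ X.1 0 + X.1 1 + X.1 2 = 0 ∧ X.1 1 * X.1 2 = (X.2 0).ip (X.2 0) ∧
      (X.2 1).ip (X.2 1) = -X.1 0 * X.1 2 ∧ (X.2 2).ip (X.2 2) = -X.1 0 * X.1 1 ∧
      (X.2 1 * X.2 2).conj = -X.1 0 • X.2 0 ∧ X.2 2 * X.2 0 = X.1 1 • (X.2 1).conj := by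
  obtain ⟨hc, ht, hneg⟩ := hX
  rw [ip_comm, ip_E1] at hneg
  rw [tr_eq] at ht
  rw [cross_self] at hc
  obtain ⟨e0, e1, e2, e3, e4, -⟩ := h1_eq_zero hc
  refine ⟨hneg, ht, by linarith, by linarith, by linarith, ?_, ?_⟩
  · linear_combination (norm := module) -e3
  · have h := congrArg Oct.conj e4
    simp only [Oct.conj_add, Oct.conj_neg, Oct.conj_smul, Oct.conj_conj, Oct.conj_zero] at h
    linear_combination (norm := module) h

/-- The pairing is -ξ₁ + ξ₂ + 2 Re x₃ with (Re x₃)² ≤ |x₃|² = -ξ₁ξ₂, so this is the inequality of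
arithmetic and geometric means for -ξ₁ > 0 and ξ₂ ≥ 0. -/
theorem ip_sigma_Pm_nonneg {X : J1} (hX : X ∈ NullCone) : 0 ≤ ip X (act sigma Pm) := by
  obtain ⟨hneg, ht, e0, e1, e2, -⟩ := null_cone_equations hX
  have hr := Oct.re_sq_le (X.2 2)
  have n2 := Oct.ip_self_nonneg (X.2 2)
  have h1 : 0 ≤ X.1 1 := by nlinarith
  rw [ip_sigma_Pm]
  by_contra hlt
  nlinarith [sq_nonneg (X.1 0 + X.1 1)]

/-- The equality case of the means forces ξ₂ = -ξ₁ and thus ξ₃ = 0, which kills x₁ and x₂, and it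
makes x₃ equal to its real part. -/
theorem eq_smul_sigma_Pm {X : J1} (hX : X ∈ NullCone) (h : ip X (act sigma Pm) = 0) :
    ∃ r : ℝ, 0 < r ∧ X = r • act sigma Pm := by
  obtain ⟨hneg, ht, e0, e1, e2, -⟩ := null_cone_equations hX
  have hr := Oct.re_sq_le (X.2 2)
  rw [ip_sigma_Pm] at h
  have hre : (X.2 2).re = (X.1 0 - X.1 1) / 2 := by linarith
  have h1 : X.1 1 = -X.1 0 := by
    rw [e2, hre] at hr
    have : (X.1 0 + X.1 1) ^ 2 = 0 := le_antisymm (by nlinarith) (sq_nonneg _)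
    have := pow_eq_zero_iff (two_ne_zero) |>.1 this
    linarith
  have h2 : X.1 2 = 0 := by linarith
  have hc : (X.2 2).re = X.1 0 := by linarith
  refine ⟨-X.1 0, by linarith, ?_⟩
  have x0 : X.2 0 = 0 := Oct.ip_self_eq_zero.1 (by rw [← e0, h2, mul_zero])
  have x1 : X.2 1 = 0 := Oct.ip_self_eq_zero.1 (by rw [e1, h2, mul_zero])
  have x2 : X.2 2 = X.1 0 • 1 := by
    rw [← sub_eq_zero, ← Oct.ip_self_eq_zero, Oct.ip_sub, Oct.ip_sub_left, Oct.ip_sub_left,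
      Oct.ip_smul_left, Oct.ip_smul, Oct.ip_smul, Oct.ip_smul_left, Oct.ip_comm (X.2 2) 1,
      Oct.one_ip, Oct.one_ip, e2, hc, h1]
    simp [Oct.re]
  rw [sigma_Pm, h1_smul]
  nth_rw 1 [eq_h1 X]
  apply h1_congr <;> simp [*]

theorem ip_exp_Gm_Pm {x p : Oct ℝ} (hp : p.re = 0) :
    ip (NormedSpace.exp (Gm1 x + Gm2 p) Pm) (act sigma Pm) = 4 := by
  rw [exp_Gm_Pm hp, ip_sigma_Pm]
  have : ((1 - 4 * p.ip p - x.ip x ^ 2) • (1 : Oct ℝ) + (4 : ℝ) • p).re =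
      1 - 4 * p.ip p - x.ip x ^ 2 := by
    simp [Oct.re] at hp ⊢
    exact hp
  simp [h1, this]
  ring

theorem nGm_eq (g : F4) : nGm g = NormedSpace.exp
    (Gm1 (-(ip (act g Pm) (act sigma Pm))⁻¹ • ((act g Pm).2 0 + ((act g Pm).2 1).conj))
      + Gm2 ((ip (act g Pm) (act sigma Pm))⁻¹ • ((act g Pm).2 2 - ((act g Pm).2 2).re • 1))) := by
  rw [nGm]
  simp only [ip_Qm, ip_F3, ← smul_smul _ (Oct.ip _ _)]
  rw [← Finset.smul_sum, ← Finset.smul_sum, Oct.sum_ip_smul_e, Oct.sum_ip_smul_e_succ, smul_smul,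
    smul_smul]
  congr 4 <;> ring

theorem nGm_of_act_Pm {g : F4} {c : ℝ} {x p : Oct ℝ} (hc : c ≠ 0) (hp : p.re = 0)
    (h : act g Pm = c • NormedSpace.exp (Gm1 x + Gm2 p) Pm) :
    nGm g = NormedSpace.exp (Gm1 x + Gm2 p) := by
  rw [nGm_eq, h, ip_smul_left, ip_exp_Gm_Pm hp, exp_Gm_Pm hp, h1_smul]
  have hre : (c • ((1 - 4 * p.ip p - x.ip x ^ 2) • (1 : Oct ℝ) + (4 : ℝ) • p)).re =
      c * (1 - 4 * p.ip p - x.ip x ^ 2) := by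
    simp [Oct.re] at hp ⊢
    exact Or.inr hp
  congr 3
  · simp only [h1, Matrix.cons_val, Oct.conj_smul, Oct.conj_sub, Oct.conj_conj]
    match_scalars <;> field_simp <;> ring
  · simp only [h1, Matrix.cons_val, hre]
    match_scalars <;> field_simp <;> ring

/-- The parameters are forced. In `exp_Gm_Pm` the pairing with σP⁻ is 4, the combination x₁ + x̄₂ of
entries is -4x, and the imaginary part of x₃ is 4p. The null cone equations then make all remaining
entries agree. -/
theorem eq_smul_exp_Gm_Pm {X : J1} (hX : X ∈ NullCone) {s : ℝ} (hs : s = ip X (act sigma Pm))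
    (h : 0 < s) : X = (s / 4) • NormedSpace.exp (Gm1 (-s⁻¹ • (X.2 0 + (X.2 1).conj))
      + Gm2 (s⁻¹ • (X.2 2 - (X.2 2).re • 1))) Pm := by
  obtain ⟨hneg, ht, e0, e1, e2, e3, e4⟩ := null_cone_equations hX
  have hp : (s⁻¹ • (X.2 2 - (X.2 2).re • 1)).re = 0 := by
    rw [Oct.re_smul, Oct.re_sub_re, mul_zero]
  rw [exp_Gm_Pm hp, h1_smul]
  rw [ip_sigma_Pm] at hs
  set c := (X.2 2).re with hc
  set w := X.2 0 + (X.2 1).conj with hw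
  set q := X.2 2 - c • 1 with hq
  -- Pair the equation for the conjugate of x₂x₃ with x̄₂ and cancel ξ₁ ≠ 0. This and the next three
  -- identities express |x|², |p|² and px through the entries of X.
  have hcross : (X.2 0).ip (X.2 1).conj = c * X.1 2 := by
    have h1 := congrArg (fun v => v.ip (X.2 1).conj) e3
    simp only [Oct.ip_conj_conj, Oct.ip_smul_left] at h1
    have h2 := Oct.conj_mul_add (X.2 1) (X.2 1)
    have h3 : (X.2 1).conj * X.2 1 = (X.2 1).ip (X.2 1) • 1 := by
      linear_combination (norm := module) (1 / 2 : ℝ) • h2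
    rw [Oct.ip_comm, Oct.ip_mul, h3, Oct.ip_smul, Oct.ip_comm (X.2 2), Oct.one_ip, e1] at h1
    have := hneg.ne
    exact mul_left_cancel₀ (neg_ne_zero.2 this) (by linarith)
  have hww : w.ip w = X.1 2 * s := by
    rw [hw, Oct.ip_add, Oct.ip_add_left, Oct.ip_add_left, Oct.ip_comm (X.2 1).conj, hcross,
      Oct.ip_conj_conj, ← e0, e1, hs]
    ring
  have hqq : q.ip q = -X.1 0 * X.1 1 - c ^ 2 := by
    rw [hq, Oct.ip_sub, Oct.ip_sub_left, Oct.ip_sub_left, Oct.ip_smul_left, Oct.ip_smul,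
      Oct.ip_smul, Oct.ip_smul_left, Oct.ip_comm (X.2 2) 1, Oct.one_ip, Oct.one_ip, e2, ← hc]
    simp [Oct.re]
    ring
  have hqw : q * w = (X.1 1 + c) • (X.2 1).conj + (X.1 0 - c) • X.2 0 := by
    have h1 : X.2 2 * (X.2 1).conj = (2 * c) • (X.2 1).conj + X.1 0 • X.2 0 := by
      have : X.2 2 = (2 * c) • 1 - (X.2 2).conj := by rw [Oct.conj_eq, ← hc]; module
      rw [this, Oct.sub_mul, ← Oct.conj_mul, e3, Oct.smul_mul, Oct.one_mul]
      module
    rw [hq, hw, Oct.sub_mul, Oct.mul_add, e4, h1, Oct.smul_mul, Oct.one_mul]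
    module
  have hs0 := h.ne'
  have hN : (-s⁻¹ • w).ip (-s⁻¹ • w) = X.1 2 / s := by
    rw [Oct.ip_smul, Oct.ip_smul_left, hww]; field_simp
  have hPp : (s⁻¹ • q).ip (s⁻¹ • q) = (-X.1 0 * X.1 1 - c ^ 2) / s ^ 2 := by
    rw [Oct.ip_smul, Oct.ip_smul_left, hqq]; field_simp
  have hpx : (s⁻¹ • q) * (-s⁻¹ • w) =
      (-(s ^ 2)⁻¹) • ((X.1 1 + c) • (X.2 1).conj + (X.1 0 - c) • X.2 0) := by
    rw [Oct.smul_mul, Oct.mul_smul, hqw, smul_smul]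
    congr 1
    field_simp
  rw [hN, hPp, hpx]
  have h2 : X.1 2 = -X.1 0 - X.1 1 := by linarith
  nth_rw 1 [eq_h1 X]
  apply h1_congr
  · rw [h2]; field_simp; rw [hs]; ring
  · rw [h2]; field_simp; rw [hs]; ring
  · field_simp
  · rw [hw]
    match_scalars <;> field_simp <;> rw [h2, hs] <;> ring
  · simp only [Oct.conj_smul, Oct.conj_add, Oct.conj_conj, hw]
    match_scalars <;> field_simp <;> rw [h2, hs] <;> ring
  · rw [hq]
    match_scalars <;> field_simp
    rw [h2, hs]; ring

/-! ### The Bruhat and Gauss decompositions -/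

theorem act_mul_mul_Pm {m a n : F4} {t : ℝ} (hm : m ∈ M)
    (ha : act a = NormedSpace.exp (t • Atilde 2 1)) (hn : n ∈ Np) :
    act (m * a * n) Pm = Real.exp (2 * t) • Pm := by
  obtain ⟨x, p, hp, hn⟩ := hn
  rw [act_mul_apply, act_mul_apply, hn, exp_Gp_Pm hp, ha, exp_Atilde_Pm, map_smul,
    (mem_M_iff.1 hm).2]

/-- By the Iwasawa decomposition only the factor k matters: it scales P⁻, and pairing with the fixed
vector E₁ shows that the scale is 1, so that k lies in M. -/
theorem mem_MANp_iff {g : F4} : g ∈ M * A * Np ↔ ∃ c : ℝ, 0 < c ∧ act g Pm = c • Pm := by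
  constructor
  · rintro ⟨_, ⟨m, hm, a, ⟨t, ha⟩, rfl⟩, n, hn, rfl⟩
    exact ⟨_, Real.exp_pos _, act_mul_mul_Pm hm ha hn⟩
  · rintro ⟨c, hc, h⟩
    obtain ⟨k, hk, a, ⟨t, ha⟩, n, ⟨x, p, hp, hn⟩, rfl, -⟩ := iwasawa g
    rw [act_mul_apply, act_mul_apply, hn, exp_Gp_Pm hp, ha, exp_Atilde_Pm, map_smul] at h
    have hE := mem_K_iff.1 hk
    have hkP : act k Pm = (c / Real.exp (2 * t)) • Pm := by
      rw [div_eq_inv_mul, ← smul_smul, ← h, smul_smul, inv_mul_cancel₀ (Real.exp_pos _).ne',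
        one_smul]
    have h1 : c / Real.exp (2 * t) = 1 := by
      have h2 := ip_act k Pm E1
      rw [hE, hkP, ip_smul_left, ip_E1] at h2
      have h3 : Pm.1 0 = -1 := rfl
      rw [h3] at h2
      linarith
    rw [h1, one_smul] at hkP
    exact ⟨_, ⟨k, mem_M_iff.2 ⟨hE, hkP⟩, a, ⟨t, ha⟩, rfl⟩, n, ⟨x, p, hp, hn⟩, rfl⟩

theorem act_sigma_Pm_of_mem_Nm {n : F4} (hn : n ∈ Nm) : act n (act sigma Pm) = act sigma Pm := by
  obtain ⟨x, p, hp, hn⟩ := hn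
  rw [hn, exp_Gm_sigma_Pm hp]

theorem act_inv_sigma_Pm_of_mem_Nm {n : F4} (hn : n ∈ Nm) :
    act n⁻¹ (act sigma Pm) = act sigma Pm := by
  nth_rw 1 [← act_sigma_Pm_of_mem_Nm hn]
  rw [act_inv_act]

theorem ip_Pm_sigma_Pm : ip Pm (act sigma Pm) = 4 := by
  rw [ip_sigma_Pm]
  simp [Pm, h1, Oct.re]
  norm_num

theorem ip_sigma_Pm_sigma_Pm : ip (act sigma Pm) (act sigma Pm) = 0 := by
  rw [ip_act, ip_Pm]
  simp [Pm, h1, Oct.re]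
  norm_num

theorem mem_sigma_MANp_iff {g : F4} :
    g ∈ {sigma} * M * A * Np ↔ ∃ c : ℝ, 0 < c ∧ act g Pm = c • act sigma Pm := by
  rw [mul_assoc, mul_assoc, ← mul_assoc M, Set.singleton_mul]
  constructor
  · rintro ⟨h, hh, rfl⟩
    obtain ⟨c, hc, h⟩ := mem_MANp_iff.1 hh
    exact ⟨c, hc, by rw [act_mul_apply, h, map_smul]⟩
  · rintro ⟨c, hc, h⟩
    refine ⟨sigma * g, mem_MANp_iff.2 ⟨c, hc, ?_⟩, ?_⟩
    · rw [act_mul_apply, h, map_smul, act_sigma_sigma]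
    · change sigma * (sigma * g) = g
      rw [← mul_assoc, sigma_mul_self, one_mul]

theorem ip_act_Pm_nonneg (g : F4) : 0 ≤ ip (act g Pm) (act sigma Pm) :=
  ip_sigma_Pm_nonneg (act_Pm_mem g)

theorem mem_sigma_MANp_iff_ip {g : F4} :
    g ∈ {sigma} * M * A * Np ↔ ip (act g Pm) (act sigma Pm) = 0 := by
  rw [mem_sigma_MANp_iff]
  constructor
  · rintro ⟨c, -, h⟩
    rw [h, ip_smul_left, ip_sigma_Pm_sigma_Pm, mul_zero]
  · exact eq_smul_sigma_Pm (act_Pm_mem g)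

/-- The value of `g P⁻` for `g = z l b z'`. -/
theorem act_Pm_of_eq_mul {z l b z' : F4} {t : ℝ} (hl : l ∈ M)
    (hb : act b = NormedSpace.exp (t • Atilde 2 1)) (hz' : z' ∈ Np) :
    act (z * l * b * z') Pm = Real.exp (2 * t) • act z Pm := by
  rw [mul_assoc z, mul_assoc z, act_mul_apply, act_mul_mul_Pm hl hb hz', map_smul]

theorem ip_act_Pm_of_eq_mul {z l b z' : F4} {t : ℝ} (hz : z ∈ Nm) (hl : l ∈ M)
    (hb : act b = NormedSpace.exp (t • Atilde 2 1)) (hz' : z' ∈ Np) :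
    ip (act (z * l * b * z') Pm) (act sigma Pm) = 4 * Real.exp (2 * t) := by
  rw [act_Pm_of_eq_mul hl hb hz', ip_smul_left, ip_act_left, act_inv_sigma_Pm_of_mem_Nm hz,
    ip_Pm_sigma_Pm, mul_comm]

theorem ip_pos_of_mem {g : F4} (hg : g ∈ Nm * M * A * Np) :
    0 < ip (act g Pm) (act sigma Pm) := by
  obtain ⟨_, ⟨_, ⟨z, hz, l, hl, rfl⟩, b, ⟨t, hb⟩, rfl⟩, z', hz', rfl⟩ := hg
  rw [ip_act_Pm_of_eq_mul hz hl hb hz']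
  positivity

theorem gauss {g : F4} (hg : 0 < ip (act g Pm) (act sigma Pm)) :
    ∃ n ∈ Nm, ∃ m ∈ M, ∃ a ∈ A, ∃ n' ∈ Np, g = n * m * a * n' ∧ act n = nGm g := by
  set s := ip (act g Pm) (act sigma Pm) with hs
  have hX := eq_smul_exp_Gm_Pm (act_Pm_mem g) hs hg
  set x := -s⁻¹ • ((act g Pm).2 0 + ((act g Pm).2 1).conj)
  set p := s⁻¹ • ((act g Pm).2 2 - ((act g Pm).2 2).re • 1) with hpdef
  have hp : p.re = 0 := by rw [hpdef, Oct.re_smul, Oct.re_sub_re, mul_zero]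
  let n : F4 := expDer (Gm1 x + Gm2 p) (.Gm x hp)
  have hn : act n = NormedSpace.exp (Gm1 x + Gm2 p) := rfl
  have hmem : n⁻¹ * g ∈ M * A * Np := by
    refine mem_MANp_iff.2 ⟨s / 4, by positivity, ?_⟩
    rw [act_mul_apply, hX, map_smul, ← hn, act_inv_act]
  obtain ⟨_, ⟨m, hm, a, ha, rfl⟩, n', hn', h⟩ := hmem
  refine ⟨n, ⟨x, p, hp, hn⟩, m, hm, a, ha, n', hn', ?_, by rw [nGm_eq, hn]⟩
  rw [mul_assoc n, mul_assoc n, eq_comm, ← eq_inv_mul_iff_mul_eq]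
  exact h

theorem mem_NmMANp_iff {g : F4} :
    g ∈ Nm * M * A * Np ↔ 0 < ip (act g Pm) (act sigma Pm) := by
  refine ⟨ip_pos_of_mem, fun h => ?_⟩
  obtain ⟨n, hn, m, hm, a, ha, n', hn', rfl, -⟩ := gauss h
  exact ⟨_, ⟨_, ⟨n, hn, m, hm, rfl⟩, a, ha, rfl⟩, n', hn', rfl⟩

theorem continuous_ip_act (X V : J1) : Continuous fun g : F4 => ip (act g X) V := by
  let f : J1 →ₗ[ℝ] ℝ :=
    { toFun := fun Y => ip Y V
      map_add' := fun Y Z => ip_add_left Y Z V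
      map_smul' := fun r Y => ip_smul_left r Y V }
  have hact : Continuous act := Units.continuous_val.comp continuous_subtype_val
  exact (LinearMap.continuous_of_finiteDimensional f).comp (hact.clm_apply continuous_const)

/-- Used for density: the P⁻-component is quadratic in t, so for p ≠ 0 the pairing with σP⁻ becomes
positive as soon as t ≠ 0. -/
theorem exp_smul_Gp_sigma_Pm {p : Oct ℝ} (hp : p.re = 0) (t : ℝ) :
    NormedSpace.exp (t • (Gp1 0 + Gp2 p)) (act sigma Pm) =
      act sigma Pm + (-4 * t) • F3 p + (4 * t ^ 2 * p.ip p) • Pm := by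
  have h0 : (Gp1 0 + Gp2 p) (act sigma Pm) = (-4 : ℝ) • F3 p := by
    rw [sigma_Pm, Gp_h1 hp, F3, h1_smul]
    have h : p.ip 1 = 0 := by rw [Oct.ip_comm, Oct.one_ip, hp]
    apply h1_congr <;> simp [Oct.one_mul, Oct.mul_one, Oct.mul_zero, Oct.zero_mul, h, Oct.conj_neg,
      Oct.neg_mul, Oct.mul_neg, Oct.ip_neg]
    module
  have h1 : (Gp1 0 + Gp2 p) (F3 p) = (-(2 * p.ip p)) • Pm := by
    have hQ : Qp 0 = 0 := by rw [Qp, Oct.conj_zero, h1_zero]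
    rw [Gp_F3 hp hp, Oct.mul_zero, neg_zero, hQ, zero_add]
  have p1 : ((t • (Gp1 0 + Gp2 p)) ^ 1) (act sigma Pm) = (-4 * t) • F3 p := by
    rw [pow_one, smul_apply, h0, smul_smul, mul_comm]
  have p2 : ((t • (Gp1 0 + Gp2 p)) ^ 2) (act sigma Pm) = (8 * t ^ 2 * p.ip p) • Pm := by
    rw [pow_succ', mul_apply_eq_comp, p1, map_smul, smul_apply, h1, smul_smul, smul_smul]
    congr 1; ring
  have p3 : ((t • (Gp1 0 + Gp2 p)) ^ 3) (act sigma Pm) = 0 := by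
    rw [pow_succ', mul_apply_eq_comp, p2, map_smul, smul_apply, Gp_Pm hp, smul_zero, smul_zero]
  rw [exp_apply_of_pow_apply_eq_zero p3]
  simp only [Finset.sum_range_succ, Finset.sum_range_zero, p1, p2, pow_zero, one_apply_eq_self,
    zero_add, smul_smul]
  norm_num [Nat.factorial]
  module

theorem dense_NmMANp : Dense (Nm * M * A * Np) := by
  intro g
  by_cases hg : ip (act g Pm) (act sigma Pm) = 0
  · obtain ⟨c, hc, hgP⟩ := eq_smul_sigma_Pm (act_Pm_mem g) hg
    have hp : (Oct.e 1).re = 0 := Oct.re_e_succ 0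
    have hpp : (Oct.e 1).ip (Oct.e 1) = 1 := by rw [Oct.ip_eq]; simp [Oct.e]
    -- Any nonzero imaginary unit would serve. If gP⁻ = cσP⁻, then exp(tD)g pairs to 16ct² and tends
    -- to g as t → 0.
    let D := Gp1 0 + Gp2 (Oct.e 1)
    let γ : ℝ → F4 := fun t => expDer (t • D) ((IsDerivation.Gp 0 hp).smul t)
    have hγ : Continuous γ :=
      (continuous_expUnit.comp (continuous_id.smul continuous_const)).subtype_mk _
    have hγ0 : γ 0 = 1 := by
      refine act_injective ?_
      change NormedSpace.exp ((0 : ℝ) • D) = 1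
      rw [zero_smul, NormedSpace.exp_zero]
    have hlim : Filter.Tendsto (fun t => γ t * g) (nhdsWithin 0 {0}ᶜ) (nhds g) := by
      have h := ((hγ.mul continuous_const).tendsto (f := fun t => γ t * g) 0)
      rw [hγ0, one_mul] at h
      exact h.mono_left nhdsWithin_le_nhds
    refine mem_closure_of_tendsto hlim (Filter.eventually_of_mem self_mem_nhdsWithin ?_)
    intro t ht
    rw [Set.mem_compl_singleton_iff] at ht
    refine mem_NmMANp_iff.2 ?_
    rw [act_mul_apply, hgP, map_smul]
    change 0 < ip (c • NormedSpace.exp (t • (Gp1 0 + Gp2 (Oct.e 1))) (act sigma Pm)) _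
    rw [exp_smul_Gp_sigma_Pm hp, ip_smul_left, ip_add_left, ip_add_left, ip_smul_left,
      ip_smul_left, ip_sigma_Pm_sigma_Pm, ip_Pm_sigma_Pm, ip_sigma_Pm (F3 _), hpp]
    have h3 : -(F3 (Oct.e 1)).1 0 + (F3 (Oct.e 1)).1 1 + 2 * ((F3 (Oct.e 1)).2 2).re = 0 := by
      simp [F3, h1, hp]
    rw [h3]
    have := pow_pos (abs_pos.2 ht) 2
    rw [sq_abs] at this
    nlinarith [mul_pos hc this]
  · exact subset_closure (mem_NmMANp_iff.2 ((ip_act_Pm_nonneg g).lt_of_ne' hg))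

theorem ray_eq_iff {X Y : J1} (hX : X ∈ NullCone) (hY : Y ∈ NullCone) :
    ray X hX = ray Y hY ↔ ∃ r : ℝ, 0 < r ∧ Y = r • X :=
  ⟨fun h => Quotient.exact h, fun h => Quotient.sound h⟩

end Exceptional

end

/-! ### Assembly of the Iwasawa, Bruhat and Gauss statements. -/

theorem theorem9p10 :
    -- `n_I` is the `N⁺`-factor in the (unique) Iwasawa decomposition
    (∀ g : F4, ∃ k ∈ K, ∃ a ∈ A, ∃ n ∈ Np, g = k * a * n ∧ act n = nI g ∧
      ∀ k' ∈ K, ∀ a' ∈ A, ∀ n' ∈ Np, g = k' * a' * n' → k' = k ∧ a' = a ∧ n' = n) ∧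
    -- (1) the Bruhat decomposition
    (Nm * M * A * Np ∪ {sigma} * M * A * Np = Set.univ ∧
      Disjoint (Nm * M * A * Np) ({sigma} * M * A * Np) ∧
      Nm * M * A * Np = {g : F4 | ip (act g Pm) (act sigma Pm) ≠ 0} ∧
      Nm * M * A * Np = {g : F4 | 0 < ip (act g Pm) (act sigma Pm)} ∧
      {sigma} * M * A * Np = Nm * {sigma} * M * A * Np ∧
      {sigma} * M * A * Np = {g : F4 | ip (act g Pm) (act sigma Pm) = 0} ∧
      {sigma} * M * A * Np = {g : F4 | ∃ h : act g Pm ∈ NullCone,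
        ray (act g Pm) h = ray (act sigma Pm) sigma_Pm_mem} ∧
      IsOpen (Nm * M * A * Np) ∧ Dense (Nm * M * A * Np)) ∧
    -- (2) the Gauss decomposition
    (∀ g ∈ Nm * M * A * Np, ∃ n ∈ Nm, ∃ m ∈ M, ∃ a ∈ A, ∃ n' ∈ Np,
      g = n * m * a * n' ∧
      (∀ z ∈ Nm, ∀ l ∈ M, ∀ b ∈ A, ∀ z' ∈ Np,
        g = z * l * b * z' → z = n ∧ l = m ∧ b = a ∧ z' = n') ∧
      act a = aG g ∧
      act n = nGm g ∧
      act n' = nI (n⁻¹ * g) ∧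
      m = n⁻¹ * g * n'⁻¹ * a⁻¹) := by
  refine ⟨iwasawa, ⟨?_, ?_, ?_, ?_, ?_, ?_, ?_, ?_, dense_NmMANp⟩, ?_⟩
  · refine Set.eq_univ_of_forall fun g => ?_
    rcases (ip_act_Pm_nonneg g).eq_or_lt with h | h
    · exact Or.inr (mem_sigma_MANp_iff_ip.2 h.symm)
    · exact Or.inl (mem_NmMANp_iff.2 h)
  · refine Set.disjoint_left.2 fun g h h' => ?_
    exact (mem_NmMANp_iff.1 h).ne' (mem_sigma_MANp_iff_ip.1 h')
  · ext g
    rw [mem_NmMANp_iff]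
    exact ⟨fun h => h.ne', fun h => (ip_act_Pm_nonneg g).lt_of_ne' h⟩
  · ext g
    exact mem_NmMANp_iff
  · have hassoc : Nm * {sigma} * M * A * Np = Nm * ({sigma} * M * A * Np) := by
      simp only [mul_assoc]
    rw [hassoc]
    refine Set.Subset.antisymm (fun g hg => ?_) ?_
    -- Any element of N⁻ would do here, since n⁻¹ also fixes σP⁻ and therefore preserves the set
    -- σMAN⁺.
    · let n : F4 := expDer (Gm1 0 + Gm2 0) (.Gm 0 rfl)
      have hn : n ∈ Nm := ⟨0, 0, rfl, rfl⟩
      obtain ⟨c, hc, h⟩ := mem_sigma_MANp_iff.1 hg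
      refine ⟨n, hn, n⁻¹ * g, mem_sigma_MANp_iff.2 ⟨c, hc, ?_⟩, mul_inv_cancel_left n g⟩
      rw [act_mul_apply, h, map_smul, act_inv_sigma_Pm_of_mem_Nm hn]
    · rintro _ ⟨n, hn, g, hg, rfl⟩
      obtain ⟨c, hc, h⟩ := mem_sigma_MANp_iff.1 hg
      refine mem_sigma_MANp_iff.2 ⟨c, hc, ?_⟩
      rw [act_mul_apply, h, map_smul, act_sigma_Pm_of_mem_Nm hn]
  · ext g
    exact mem_sigma_MANp_iff_ip
  · ext g
    rw [mem_sigma_MANp_iff]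
    constructor
    · rintro ⟨c, hc, h⟩
      refine ⟨act_Pm_mem g, (ray_eq_iff _ _).2 ⟨c⁻¹, inv_pos.2 hc, ?_⟩⟩
      rw [h, smul_smul, inv_mul_cancel₀ hc.ne', one_smul]
    · rintro ⟨hX, h⟩
      obtain ⟨r, hr, h⟩ := (ray_eq_iff _ _).1 h
      refine ⟨r⁻¹, inv_pos.2 hr, ?_⟩
      rw [h, smul_smul, inv_mul_cancel₀ hr.ne', one_smul]
  · have h : Nm * M * A * Np = {g : F4 | 0 < ip (act g Pm) (act sigma Pm)} :=
      Set.ext fun g => mem_NmMANp_iff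
    rw [h]
    exact isOpen_lt continuous_const (continuous_ip_act _ _)
  · intro g hg
    have hpos := ip_pos_of_mem hg
    -- The vector gP⁻ determines the N⁻-factor, and its pairing with σP⁻ determines the A-factor,
    -- for every factorization at once.
    have hfactors {z l b z' : F4} (hz : z ∈ Nm) (hl : l ∈ M) (hb : b ∈ A) (hz' : z' ∈ Np)
        (h : g = z * l * b * z') : act z = nGm g ∧ act b = aG g := by
      obtain ⟨t, hb⟩ := hb
      have h1 := ip_act_Pm_of_eq_mul hz hl hb hz'
      have h2 := act_Pm_of_eq_mul (z := z) hl hb hz'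
      rw [← h] at h1 h2
      obtain ⟨x, p, hp, hz⟩ := hz
      rw [hz] at h2
      refine ⟨by rw [hz, nGm_of_act_Pm (Real.exp_pos _).ne' hp h2], ?_⟩
      rw [hb, aG, h1, ← mul_assoc, one_div_mul_cancel four_ne_zero, one_mul, Real.log_exp,
        ← mul_assoc, one_div_mul_cancel two_ne_zero, one_mul]
    obtain ⟨n, hn, m, hm, a, ha, n', hn', hgeq, -⟩ := gauss hpos
    obtain ⟨hn1, ha1⟩ := hfactors hn hm ha hn' hgeq
    have hrest : n⁻¹ * g = m * a * n' := by rw [hgeq]; group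
    -- Because M ⊆ K, what remains after removing the N⁻-factor is an Iwasawa factorization, whose
    -- uniqueness settles the other three factors.
    obtain ⟨k, -, b, -, u, -, -, hu, huniq⟩ := iwasawa (n⁻¹ * g)
    obtain ⟨hmk, hab, hnu⟩ := huniq m hm.1 a ha n' hn' hrest
    refine ⟨n, hn, m, hm, a, ha, n', hn', hgeq, ?_, ha1, hn1, by rw [hnu, hu], ?_⟩
    · intro z hz l hl b' hb z' hz' h
      obtain ⟨hz1, -⟩ := hfactors hz hl hb hz' h
      have hzn : z = n := act_injective (by rw [hz1, hn1])
      have hrest' : n⁻¹ * g = l * b' * z' := by rw [h, hzn]; group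
      obtain ⟨h1, h2, h3⟩ := huniq l hl.1 b' hb z' hz' hrest'
      exact ⟨hzn, by rw [h1, hmk], by rw [h2, hab], by rw [h3, hnu]⟩
    · rw [hrest]; group
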